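/- **Setting.** Let $d\ge 1$, let $\mathbb R^d$ carry a fixed norm $\|\cdot\|$ (with $B(x,\rho)$ its open balls, and the maximum norm on $\mathbb R^{2d}$), and let $(M,g)$ be a $d$-dimensional (Hausdorff, smooth) Riemannian manifold. Let $\mathcal A=\{\kappa:\widetilde U_\kappa\to U_\kappa\}$ be a locally finite atlas of $M$ such that some point of $M$ lies in only one $\widetilde U_\kappa$. Let $R>0$ and let $(r_\kappa)$, $(\varepsilon_\kappa)$ be families of positive numbers with $\inf_\kappa r_\kappa>0$, $\inf_\kappa\varepsilon_\kappa>0$ to which $\mathcal A$ is adapted: $\overline B(0,r_\kappa+R)\subseteq U_\kappa$, $r_\kappa<(\frac1{2\varepsilon_\kappa}-1)R$, and the sets $\kappa^{-1}(B(0,r_\kappa))$ cover $M$. Put $V_\kappa:=B(0,r_\kappa+R)$ and let $\mathcal B$ be the atlas of the restrictions of the $\kappa$ to $\kappa^{-1}(V_\kappa)$. Write $g_\kappa$ for the metric on $U_\kappa$ induced by $g$ and $X_\kappa:=d\kappa\circ X\circ\kappa^{-1}$ for vector fields $X$. **Weights.** Let $\overline{\mathbb R}:=\mathbb R\cup\{\infty\}$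 and, for a map $\varphi$ on a set $S$ and $f:S\to\overline{\mathbb R}$, $\|\varphi\|_{f,\ell}:=\sup_{x\in S}|f(x)|\,\|D^\ell\varphi(x)\|_{op}$. For a family of sets $S_i$ and a set $\mathcal V$ of weights on $\bigsqcup_iS_i$, let $\mathcal V_{\max}$ be the set of weights $f$ such that $\sup_i\|\cdot\|_{f_i,0}$ is a continuous seminorm on the space of families of continuous maps $S_i\to Y_i$ all of whose seminorms $\sup_i\|\cdot\|_{h_i,0}$ ($h\in\mathcal V$) are finite, for all families of normed spaces $Y_i$. For $f\in\overline{\mathbb R}^M$ and a vector field $X$ let $\|X\|^{\mathcal A}_{f,\ell}:=\sup_{\kappa\in\mathcal A}\|X_\kappa\|_{f\circ\kappa^{-1},\ell}$, likewise for $\mathcal B$ (with $X_\kappa$ restricted to $V_\kappa$), and for a set $\mathcal V$ of weights on $M$ let $C^\infty_{\mathcal V}(M)_{\mathcal A}$ be the space of smooth vector fields with $\|X\|^{\mathcal A}_{f,\ell}<\infty$ for all $f\in\mathcal V$, $\ell\in\mathbb N$, with the topology defined by these seminorms. **Constants.** For an open $U\subseteq\mathbb R^d$ with Riemannian metric $h$,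 let $\exp^h$ have its maximal domain $D_h\subseteq U\times\mathbb R^d$, and let $\log^h(x,y)$ be the inverse of $\exp^h_x$ on the largest $h_x$-ball around $0$ contained in its domain on which it is injective. Let $E_\kappa$ be the supremum of all $\tau>0$ with $\overline{V_\kappa}\times B(0,\tau)\subseteq D_{g_\kappa}$; let $L_\kappa$ be the supremum of all $\tau>0$ such that $\log^{g_\kappa}$ is defined on $\bigcup_{x\in\overline{V_\kappa}}\{x\}\times B(x,\tau)$; let $Q_\kappa$ be the quotient of the optimal constants $c,C$ with $c\|\cdot\|\le\|\cdot\|_{(g_\kappa)_x}\le C\|\cdot\|$ for all $x\in V_\kappa$; and for $\sigma\in\,]0,1[$ let $\rho_{\kappa,\sigma}$ be the supremum of all $r\in\,]0,E_\kappa[$ with $\sup_{\|y\|\le r}\|D(\exp^{g_\kappa}_x-\mathrm{id})(y)\|<\sigma$ for all $x\in\overline{V_\kappa}$. **Data.** Let $\mathcal W\subseteq\mathbb R^M$ with $1_M\in\mathcal W$ be such that each $f\in\mathcal W$ is bounded on all compact subsets of $M$. Let $\sigma\in\,]0,1[$, $0<\delta_\kappa<\rho_{\kappa,\sigma}Q_\kappa$,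 and let $\omega:M\to\mathbb R$ be adjusted to $\mathcal B$ and $$\widetilde\delta_\kappa:=\min\Bigl(\tfrac{(1-\sigma)^2}{1+\sigma}\delta_\kappa,\ \tfrac{\varepsilon_\kappa}{4(b_\kappa+1)}\Bigr),\qquad b_\kappa:=\sup_{\overline{V_\kappa}\times\overline B(0,\delta_\kappa)}\|D^2\exp^{g_\kappa}\|,$$ that is, for some $K>0$ and every $\kappa$, $K|\omega|$ is bounded and $\ge\max(1/\widetilde\delta_\kappa,1)$ on $\kappa^{-1}(V_\kappa)$. Let $\mathcal W^e\subseteq\overline{\mathbb R}^M$ contain $\mathcal W\cup\{\omega\}$ and satisfy the following (for instance, $\mathcal W^e$ may be a minimal saturated extension of $\mathcal W\cup\{\omega\}$ that is locally $\mathcal W$-bounded): * $\mathcal W^e$ is locally $\mathcal W$-bounded: for every $h\in\mathcal W^e$ there is $f\in\mathcal W$ such that every point of $M$ has a neighbourhood on which $|h|\le C|f|$ for some $C>0$. * $\mathcal W^e$ is saturated with respect to $(\mathcal A,\mathcal B,g)$ and some $\delta^E_\kappa\in\,]0,E_\kappa[$, $\delta^L_\kappa\in\,]0,L_\kappa[$: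 with $\mathcal V$ the set of the weights $(f\circ\kappa^{-1}|_{V_\kappa})_\kappa$, $f\in\mathcal W^e$, and both for $\beta_\kappa(x,y)=\exp^{g_\kappa}(x,y)-x$ on $V_\kappa\times B(0,\delta^E_\kappa)$ and for $\beta_\kappa(x,y)=\log^{g_\kappa}(x,x+y)$ on $V_\kappa\times B(0,\delta^L_\kappa)$, for all $f\in\mathcal V$ and $\ell\ge1$ there is $h\in\mathcal V_{\max}$ with $\|\beta_\kappa\|_{1,\ell}|f_\kappa|\le|h_\kappa|$ on $V_\kappa$ for all $\kappa$. * $\mathcal W^e$ is saturated with respect to $(\mathcal A,\mathcal A)$: with $\mathcal V$ the set of the weights $(f\circ\phi^{-1}|_{\phi(\widetilde U_\kappa\cap\widetilde U_\phi)})_{(\kappa,\phi)}$, $f\in\mathcal W^e$, for all $f\in\mathcal V$ and $\ell\ge0$ there is $h\in\mathcal V_{\max}$ with $\|D(\kappa\circ\phi^{-1})\|_{1,\ell}|f_{(\kappa,\phi)}|\le|h_{(\kappa,\phi)}|$ on $\phi(\widetilde U_\kappa\cap\widetilde U_\phi)$ for all $\kappa,\phi\in\mathcal A$. For $\alpha>0$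 let $\mathcal D_\alpha$ be the set of the diffeomorphisms of $M$ of the form $\exp_g\circ X$ with $X\in C^\infty_{\mathcal W^e}(M)_{\mathcal A}$ (with image in the domain of $\exp_g$), $\|X\|^{\mathcal B}_{\omega,0}<\alpha$ and $\|X\|^{\mathcal B}_{1_M,1}<\alpha$, and let $\mathrm{Diff}^{\mathcal W}_{M,g,\omega}$ be the subgroup of $\mathrm{Diff}(M)$ generated by $\mathcal D_\alpha\cap\mathcal D_\alpha^{-1}$. Let $\mathrm{Diff}_c(M)$ be the Lie group of compactly supported diffeomorphisms, modelled on the space $C^\infty_c(M,TM)$ of compactly supported smooth vector fields with its locally convex inductive limit topology, with $X\mapsto\exp_g\circ X$ (for $X$ near $0$) as the inverse of a chart around $\mathrm{id}_M$; let $\mathrm{Diff}_c(M)_0$ be its identity component. **Claim.** $C^\infty_c(M,TM)\subseteq C^\infty_{\mathcal W^e}(M)_{\mathcal A}$ with continuous inclusion map; and for every $\alpha>0$ (in particular for all those used to construct the Lie group $\mathrm{Diff}^{\mathcal W}_{M,g,\omega}$), $$\mathrm{Diff}_c(M)_0\subseteq\mathrm{Diff}^{\mathcal W}_{M,g,\omega}.$$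 -/

import Mathlib

open Set Filter Topology Bundle
open scoped Manifold ContDiff ENNReal NNReal

noncomputable section

namespace WeightedDiffeo

/-! ## Weighted norms

Weights take values in `ℝ ∪ {∞}`, modelled by `WithTop ℝ`. All weighted norms take values in
`[0, ∞]`, with `∞ * 0 = 0`. -/

/-- The absolute value `ℝ ∪ {∞} → [0, ∞]`. -/
def wabs : WithTop ℝ → ℝ≥0∞
  | ⊤ => ⊤
  | (x : ℝ) => ENNReal.ofReal |x|

/-- `‖φ‖_{f, ℓ} = sup_{x ∈ S} |f x| ‖D^ℓ φ (x)‖`, where `f` is already given as `|f|`. -/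
def wnorm {E F : Type*} [NormedAddCommGroup E] [NormedSpace ℝ E] [NormedAddCommGroup F]
    [NormedSpace ℝ F] (S : Set E) (f : E → ℝ≥0∞) (ℓ : ℕ) (φ : E → F) : ℝ≥0∞ :=
  ⨆ x ∈ S, f x * ‖iteratedFDeriv ℝ ℓ φ x‖ₑ

/-- The weighted sup norm of order `0` of a family of maps on the sets `S i`. -/
def supNormFam {ι E : Type*} {Y : ι → Type*} [∀ i, NormedAddCommGroup (Y i)] (S : ι → Set E)
    (f : ι → E → WithTop ℝ) (φ : ∀ i, E → Y i) : ℝ≥0∞ :=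
  ⨆ i, ⨆ x ∈ S i, wabs (f i x) * ‖φ i x‖ₑ

/-- The maximal extension of a set `W` of weights on the disjoint union of the `S i`: those `f`
for which `‖·‖_{f, 0}` is a continuous seminorm on the space of families of continuous maps
`S i → Y i` all of whose norms `‖·‖_{h, 0}`, `h ∈ W`, are finite, for every family of normed
spaces `Y i`. (As the norms only see `‖φ i x‖`, the universe of the `Y i` plays no role.) -/
def maxExt {ι E : Type*} [TopologicalSpace E] (S : ι → Set E)
    (W : Set (ι → E → WithTop ℝ)) : Set (ι → E → WithTop ℝ) :=
  {f | ∀ (Y : ι → Type) [∀ i, NormedAddCommGroup (Y i)] [∀ i, NormedSpace ℝ (Y i)],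
    ∃ (F : Finset (ι → E → WithTop ℝ)) (C : ℝ≥0), (↑F : Set (ι → E → WithTop ℝ)) ⊆ W ∧
      ∀ φ : ∀ i, E → Y i, (∀ i, ContinuousOn (φ i) (S i)) → (∀ h ∈ W, supNormFam S h φ < ⊤) →
        supNormFam S f φ ≤ C * ∑ h ∈ F, supNormFam S h φ}

/-- The family `m` consists of simultaneous multipliers for `W`: for all `f ∈ W` and `ℓ` there
is `h` in the maximal extension of `W` with `‖m i‖_{1, ℓ} |f i| ≤ |h i|` on `S i` for all `i`. -/
def IsSimMultiplier {ι E F : Type*} [NormedAddCommGroup E] [NormedSpace ℝ E]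
    [NormedAddCommGroup F] [NormedSpace ℝ F] (S : ι → Set E) (W : Set (ι → E → WithTop ℝ))
    (m : ι → E → F) : Prop :=
  ∀ f ∈ W, ∀ ℓ : ℕ, ∃ h ∈ maxExt S W, ∀ i, ∀ x ∈ S i,
    wnorm (S i) (fun _ => 1) ℓ (m i) * wabs (f i x) ≤ wabs (h i x)

/-- The estimate for superposition with maps `β i` on `S i × B i`: for all `f ∈ W` and `ℓ ≥ 1`
there is `h` in the maximal extension of `W` with `‖β i‖_{1, ℓ} |f i| ≤ |h i|` on `S i` for
all `i`. -/
def IsSimSuperposition {ι E F : Type*} [NormedAddCommGroup E] [NormedSpace ℝ E]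
    [NormedAddCommGroup F] [NormedSpace ℝ F] (S B : ι → Set E) (W : Set (ι → E → WithTop ℝ))
    (β : ι → E × E → F) : Prop :=
  ∀ f ∈ W, ∀ ℓ : ℕ, 1 ≤ ℓ → ∃ h ∈ maxExt S W, ∀ i, ∀ x ∈ S i,
    wnorm (S i ×ˢ B i) (fun _ => 1) ℓ (β i) * wabs (f i x) ≤ wabs (h i x)

/-- `w` is an adjusting weight for the family `r` of elements of `]0, ∞]`. -/
def IsAdjustingWeight {ι E : Type*} (S : ι → Set E) (w : ι → E → ℝ) (r : ι → ℝ≥0∞) : Prop :=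
  ∀ i, (∃ C : ℝ, ∀ x ∈ S i, |w i x| ≤ C) ∧
    ∀ x ∈ S i, max (r i)⁻¹ 1 ≤ ENNReal.ofReal |w i x|

/-- `W₂` is locally `W₁`-bounded. -/
def LocallyBoundedBy {M : Type*} [TopologicalSpace M] (W₁ W₂ : Set (M → WithTop ℝ)) : Prop :=
  ∀ h ∈ W₂, ∃ f ∈ W₁, ∀ x, ∃ U ∈ 𝓝 x, ∃ K : ℝ≥0, 0 < K ∧ ∀ y ∈ U, wabs (h y) ≤ K * wabs (f y)

/-! ## Riemannian exponential map and logarithm on open subsets of `E` -/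

section LocalGeometry

variable {E : Type*} [NormedAddCommGroup E] [NormedSpace ℝ E]

/-- The geodesic equation `c'' + Γ(c', c') = 0` at time `t` for the metric tensor `G`, paired with
an arbitrary vector `w`: `G(c'', w) + (D_{c'} G)(c', w) - (D_w G)(c', c') / 2 = 0`. -/
def GeodesicEqAt (G : E → E →L[ℝ] E →L[ℝ] ℝ) (c : ℝ → E) (t : ℝ) : Prop :=
  (∀ᶠ s in 𝓝 t, DifferentiableAt ℝ c s) ∧ DifferentiableAt ℝ (deriv c) t ∧
    ∀ w : E, G (c t) (deriv (deriv c) t) w + fderiv ℝ G (c t) (deriv c t) (deriv c t) w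
      - (1 / 2 : ℝ) * fderiv ℝ G (c t) w (deriv c t) (deriv c t) = 0

/-- `y = exp (x, v)` for the Riemannian manifold `(U, G)`: some geodesic in `U`, defined on a
neighbourhood of `[0, 1]`, starts at `x` with velocity `v` and is at `y` at time `1`. -/
def IsLocalExp (G : E → E →L[ℝ] E →L[ℝ] ℝ) (U : Set E) (x v y : E) : Prop :=
  ∃ e > (0 : ℝ), ∃ c : ℝ → E, (∀ t ∈ Ioo (-e) (1 + e), c t ∈ U ∧ GeodesicEqAt G c t) ∧
    c 0 = x ∧ deriv c 0 = v ∧ c 1 = y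

/-- The maximal domain of the exponential map of `(U, G)`. -/
def localExpDom (G : E → E →L[ℝ] E →L[ℝ] ℝ) (U : Set E) : Set (E × E) :=
  {z | ∃ y, IsLocalExp G U z.1 z.2 y}

open Classical in
/-- The exponential map of `(U, G)` (with junk values outside its domain). -/
def localExp (G : E → E →L[ℝ] E →L[ℝ] ℝ) (U : Set E) (z : E × E) : E :=
  if h : ∃ y, IsLocalExp G U z.1 z.2 y then h.choose else 0

/-- The norm `‖h‖_{g_x}`. -/
def gnorm (G : E → E →L[ℝ] E →L[ℝ] ℝ) (x h : E) : ℝ := Real.sqrt (G x h h)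

/-- The supremum of the radii `r > 0` such that `exp_x` is defined and injective on the
`‖·‖_{g_x}`-ball of radius `r` around `0`. -/
def injRadius (G : E → E →L[ℝ] E →L[ℝ] ℝ) (U : Set E) (x : E) : ℝ≥0∞ :=
  ⨆ r : {r : ℝ // 0 < r ∧ (∀ v, gnorm G x v < r → (x, v) ∈ localExpDom G U) ∧
    InjOn (fun v => localExp G U (x, v)) {v | gnorm G x v < r}}, ENNReal.ofReal r

/-- The relation `v = log (x, y)`. -/
def IsLocalLog (G : E → E →L[ℝ] E →L[ℝ] ℝ) (U : Set E) (x y v : E) : Prop :=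
  ENNReal.ofReal (gnorm G x v) < injRadius G U x ∧ localExp G U (x, v) = y

/-- The domain of the Riemannian logarithm of `(U, G)`. -/
def localLogDom (G : E → E →L[ℝ] E →L[ℝ] ℝ) (U : Set E) : Set (E × E) :=
  {z | ∃ v, IsLocalLog G U z.1 z.2 v}

open Classical in
/-- The second component of the Riemannian logarithm of `(U, G)` (with junk values outside its
domain). -/
def localLog (G : E → E →L[ℝ] E →L[ℝ] ℝ) (U : Set E) (z : E × E) : E :=
  if h : ∃ v, IsLocalLog G U z.1 z.2 v then h.choose else 0

/-- The supremum of all `τ > 0` such that `closure K × B(0, τ)` lies in the domain of `exp`. -/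
def expBound (G : E → E →L[ℝ] E →L[ℝ] ℝ) (U K : Set E) : ℝ≥0∞ :=
  ⨆ τ : {τ : ℝ // 0 < τ ∧ closure K ×ˢ Metric.ball (0 : E) τ ⊆ localExpDom G U},
    ENNReal.ofReal τ

/-- The supremum of all `τ > 0` such that `⋃_{x ∈ closure K} {x} × B(x, τ)` lies in the domain
of `log`. -/
def logBound (G : E → E →L[ℝ] E →L[ℝ] ℝ) (U K : Set E) : ℝ≥0∞ :=
  ⨆ τ : {τ : ℝ // 0 < τ ∧ ∀ x ∈ closure K, ∀ y ∈ Metric.ball x τ, (x, y) ∈ localLogDom G U},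
    ENNReal.ofReal τ

/-- `‖exp‖_{1, 2}` on `closure K × closedBall 0 δ`, with the maximum norm on `E × E`. -/
def expSecondBound (G : E → E →L[ℝ] E →L[ℝ] ℝ) (U K : Set E) (δ : ℝ) : ℝ≥0∞ :=
  wnorm (closure K ×ˢ Metric.closedBall (0 : E) δ) (fun _ => 1) 2 (localExp G U)

/-- The quotient of the best constants in `c ‖·‖ ≤ ‖·‖_{g_x} ≤ C ‖·‖` for all `x ∈ K`. -/
def quotNorm (G : E → E →L[ℝ] E →L[ℝ] ℝ) (K : Set E) : ℝ≥0∞ :=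
  (⨆ c : {c : ℝ // 0 < c ∧ ∀ x ∈ K, ∀ h, c * ‖h‖ ≤ gnorm G x h}, ENNReal.ofReal c) /
    (⨅ C : {C : ℝ // 0 < C ∧ ∀ x ∈ K, ∀ h, gnorm G x h ≤ C * ‖h‖}, ENNReal.ofReal C)

/-- The supremum of all `r ∈ ]0, expBound[` with `‖exp_x - id‖_{1, 1} < σ` on `closedBall 0 r` for
all `x ∈ closure V`. -/
def radExpFibInv (G : E → E →L[ℝ] E →L[ℝ] ℝ) (U V : Set E) (σ : ℝ) : ℝ≥0∞ :=
  ⨆ r : {r : ℝ // 0 < r ∧ ENNReal.ofReal r < expBound G U V ∧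
    ∀ x ∈ closure V, wnorm (Metric.closedBall (0 : E) r) (fun _ => 1) 1
      (fun y => localExp G U (x, y) - y) < ENNReal.ofReal σ}, ENNReal.ofReal r

/-- `(x, y) ↦ exp (x, y) - x`. -/
def expMinus (G : E → E →L[ℝ] E →L[ℝ] ℝ) (U : Set E) (z : E × E) : E := localExp G U z - z.1

/-- `(x, y) ↦ log (x, x + y)`. -/
def logPlus (G : E → E →L[ℝ] E →L[ℝ] ℝ) (U : Set E) (z : E × E) : E :=
  localLog G U (z.1, z.1 + z.2)

end LocalGeometry

/-! ## Manifolds -/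

section Manifold

variable {E : Type*} [NormedAddCommGroup E] [NormedSpace ℝ E]
  {M : Type*} [TopologicalSpace M] [ChartedSpace E M]

/-- A locally finite atlas, given as an indexed family of charts of the smooth structure. -/
structure IsLocallyFiniteAtlas {ι : Type*} (κ : ι → OpenPartialHomeomorph M E) : Prop where
  mem_maximalAtlas : ∀ i, κ i ∈ IsManifold.maximalAtlas 𝓘(ℝ, E) ∞ M
  cover : ∀ p : M, ∃ i, p ∈ (κ i).source
  locallyFinite : LocallyFinite fun i => (κ i).source

/-- The atlas `κ` is adapted to `(r, ε, R)`. -/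
structure IsAdapted {ι : Type*} (κ : ι → OpenPartialHomeomorph M E) (r ε : ι → ℝ) (R : ℝ) :
    Prop where
  r_pos : ∀ i, 0 < r i
  ε_pos : ∀ i, 0 < ε i
  R_pos : 0 < R
  closedBall_subset : ∀ i, Metric.closedBall (0 : E) (r i + R) ⊆ (κ i).target
  cover : ∀ p : M, ∃ i, p ∈ (κ i).source ∧ κ i p ∈ Metric.ball (0 : E) (r i)
  r_lt : ∀ i, r i < (1 / (2 * ε i) - 1) * R

/-- A weight on `M` in the charts of the family `κ`. -/
def weightLoc {ι : Type*} {T : Type*} (κ : ι → OpenPartialHomeomorph M E) (f : M → T) :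
    ι → E → T :=
  fun i x => f ((κ i).symm x)

/-- `W` is saturated with respect to the pair of atlases `(κ, κ)`: the differentials of the
transition maps `κ i ∘ (κ j)⁻¹` on `κ j (dom κ i ∩ dom κ j)` are simultaneous multipliers for the
localized weights `f ∘ (κ j)⁻¹`, `f ∈ W`. -/
def IsSaturatedTransition {ι : Type*} (κ : ι → OpenPartialHomeomorph M E)
    (W : Set (M → WithTop ℝ)) : Prop :=
  IsSimMultiplier (fun q : ι × ι => ((κ q.2).symm ≫ₕ κ q.1).source)
    ((fun f => weightLoc (fun q : ι × ι => κ q.2) f) '' W)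
    (fun q : ι × ι => fderiv ℝ (κ q.1 ∘ (κ q.2).symm))

variable [IsManifold 𝓘(ℝ, E) ∞ M]

variable (E M) in
/-- Smooth vector fields on `M`. -/
abbrev VF : Type _ := Cₛ^∞⟮𝓘(ℝ, E); E, (TangentSpace 𝓘(ℝ, E) : M → Type _)⟯

variable (E M) in
/-- Smooth Riemannian metrics on `M`. -/
abbrev RMetric : Type _ :=
  ContMDiffRiemannianMetric 𝓘(ℝ, E) ∞ E (TangentSpace 𝓘(ℝ, E) : M → Type _)

/-- The metric `g_κ` on the target of the chart `κ`, pulled back along `κ⁻¹`. -/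
def localMetric (g : RMetric E M) (κ : OpenPartialHomeomorph M E) (x : E) : E →L[ℝ] E →L[ℝ] ℝ :=
  let T : E →L[ℝ] E := mfderiv 𝓘(ℝ, E) 𝓘(ℝ, E) κ.symm x
  let B : E →L[ℝ] E →L[ℝ] ℝ := g.inner (κ.symm x)
  B.bilinearComp T T

/-- The localization `X_κ = dκ ∘ X ∘ κ⁻¹` of a vector field. -/
def vfLoc (X : VF E M) (κ : OpenPartialHomeomorph M E) (x : E) : E :=
  mfderiv 𝓘(ℝ, E) 𝓘(ℝ, E) κ (κ.symm x) (X (κ.symm x))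

/-- `‖X‖_{f, ℓ}` with respect to the charts `κ i`, restricted so that their images are `S i`. -/
def vfNorm {ι : Type*} (κ : ι → OpenPartialHomeomorph M E) (S : ι → Set E) (f : M → WithTop ℝ)
    (ℓ : ℕ) (X : VF E M) : ℝ≥0∞ :=
  ⨆ i, wnorm (S i) (fun x => wabs (f ((κ i).symm x))) ℓ (vfLoc X (κ i))

/-- The smooth weighted vector fields with respect to the atlas `κ`. -/
def weightedVF {ι : Type*} (κ : ι → OpenPartialHomeomorph M E) (W : Set (M → WithTop ℝ)) :
    Set (VF E M) :=
  {X | ∀ f ∈ W, ∀ ℓ : ℕ, vfNorm κ (fun i => (κ i).target) f ℓ X < ⊤}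

/-- The locally convex topology on the weighted vector fields generated by the seminorms
`‖·‖_{f, ℓ}`, `f ∈ W`, `ℓ ∈ ℕ`. -/
@[reducible]
def weightedVFTopology {ι : Type*} (κ : ι → OpenPartialHomeomorph M E)
    (W : Set (M → WithTop ℝ)) : TopologicalSpace (weightedVF κ W) :=
  TopologicalSpace.generateFrom
    {B | ∃ f ∈ W, ∃ (ℓ : ℕ) (X : weightedVF κ W) (e : ℝ≥0∞), 0 < e ∧
      B = {Y | vfNorm κ (fun i => (κ i).target) f ℓ (Y.1 - X.1) < e}}

/-- A geodesic of `(M, g)` on the open interval `]a, b[`: a continuous curve which satisfies the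
geodesic equation in every chart of the smooth structure. -/
def IsGeodesic (g : RMetric E M) (γ : ℝ → M) (a b : ℝ) : Prop :=
  ContinuousOn γ (Ioo a b) ∧
    ∀ κ ∈ IsManifold.maximalAtlas 𝓘(ℝ, E) ∞ M, ∀ t ∈ Ioo a b, γ t ∈ κ.source →
      GeodesicEqAt (localMetric g κ) (κ ∘ γ) t

/-- `v` lies in the domain of the Riemannian exponential map of `(M, g)` and `exp_g v = q`: some
geodesic on a neighbourhood of `[0, 1]` has initial velocity `v` and is at `q` at time `1`. -/
def IsExp (g : RMetric E M) (v : TangentBundle 𝓘(ℝ, E) M) (q : M) : Prop :=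
  ∃ e > (0 : ℝ), ∃ γ : ℝ → M, IsGeodesic g γ (-e) (1 + e) ∧
    (⟨γ 0, mfderiv 𝓘(ℝ, ℝ) 𝓘(ℝ, E) γ 0 (1 : ℝ)⟩ : TangentBundle 𝓘(ℝ, E) M) = v ∧ γ 1 = q

/-- `φ = exp_g ∘ X` (in particular, the image of `X` lies in the domain of `exp_g`). -/
def IsExpComp (g : RMetric E M) (X : VF E M) (φ : M → M) : Prop :=
  ∀ p, IsExp g ⟨p, X p⟩ (φ p)

/-- `W` is saturated with respect to the atlas `κ`, its restrictions to `κ⁻¹(V i)`, the metric `g`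
and the radii `δE`, `δL`. -/
def IsSaturatedExpLog (g : RMetric E M) {ι : Type*} (κ : ι → OpenPartialHomeomorph M E)
    (V : ι → Set E) (δE δL : ι → ℝ) (W : Set (M → WithTop ℝ)) : Prop :=
  IsSimSuperposition V (fun i => Metric.ball (0 : E) (δE i)) ((fun f => weightLoc κ f) '' W)
      (fun i => expMinus (localMetric g (κ i)) (κ i).target) ∧
    IsSimSuperposition V (fun i => Metric.ball (0 : E) (δL i)) ((fun f => weightLoc κ f) '' W)
      (fun i => logPlus (localMetric g (κ i)) (κ i).target)

/-- The numbers
`min ((1 - σ)² / (1 + σ) * δ i, ε i / (4 (‖exp‖_{1, 2} on closure (V i) × closedBall 0 (δ i) + 1)))`.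
-/
def adjustRadii (g : RMetric E M) {ι : Type*} (κ : ι → OpenPartialHomeomorph M E) (V : ι → Set E)
    (ε δ : ι → ℝ) (σ : ℝ) (i : ι) : ℝ≥0∞ :=
  min (ENNReal.ofReal ((1 - σ) ^ 2 / (1 + σ) * δ i))
    (ENNReal.ofReal (ε i) /
      (4 * (expSecondBound (localMetric g (κ i)) (κ i).target (V i) (δ i) + 1)))

/-! ## Compactly supported vector fields -/

variable (E M) in
/-- The space of compactly supported smooth vector fields. -/
def compactVF : Submodule ℝ (VF E M) where
  carrier := {X | ∃ K : Set M, IsCompact K ∧ ∀ p ∉ K, X p = 0}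
  zero_mem' := ⟨∅, isCompact_empty, fun _ _ => rfl⟩
  add_mem' := by
    rintro X Y ⟨K, hK, hX⟩ ⟨L, hL, hY⟩
    refine ⟨K ∪ L, hK.union hL, fun p hp => ?_⟩
    rw [mem_union, not_or] at hp
    rw [ContMDiffSection.coe_add, Pi.add_apply, hX p hp.1, hY p hp.2, add_zero]
  smul_mem' := by
    rintro c X ⟨K, hK, hX⟩
    refine ⟨K, hK, fun p hp => ?_⟩
    rw [ContMDiffSection.coe_smul, Pi.smul_apply, hX p hp, smul_zero]

/-- A seminorm on the compactly supported vector fields which is continuous for the inductive limit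
topology: for each compact `K`, its restriction to the vector fields supported in `K` is continuous
for the topology of uniform convergence of all derivatives on compact sets in charts. -/
def IsLFSeminorm (p : Seminorm ℝ (compactVF E M)) : Prop :=
  ∀ K : Set M, IsCompact K →
    ∃ (n : ℕ) (κ : Fin n → OpenPartialHomeomorph M E) (L : Fin n → Set E) (ℓ : Fin n → ℕ)
      (C : ℝ≥0),
      (∀ i, κ i ∈ IsManifold.maximalAtlas 𝓘(ℝ, E) ∞ M ∧ IsCompact (L i) ∧
        L i ⊆ (κ i).target) ∧
      ∀ X : compactVF E M, (∀ q ∉ K, X.1 q = 0) →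
        ENNReal.ofReal (p X) ≤ C * ∑ i, wnorm (L i) (fun _ => 1) (ℓ i) (vfLoc X.1 (κ i))

variable (E M) in
/-- The locally convex inductive limit topology on the compactly supported vector fields. -/
@[reducible]
def compactVFTopology : TopologicalSpace (compactVF E M) :=
  TopologicalSpace.generateFrom
    {B | ∃ p : Seminorm ℝ (compactVF E M), IsLFSeminorm p ∧
      ∃ (X : compactVF E M) (e : ℝ), 0 < e ∧ B = {Y | p (Y - X) < e}}

/-! ## Diffeomorphism groups -/

variable (E M) in
/-- The group of smooth diffeomorphisms of `M`. -/
def diffGroup : Subgroup (Equiv.Perm M) where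
  carrier := {φ | ContMDiff 𝓘(ℝ, E) 𝓘(ℝ, E) ∞ φ ∧ ContMDiff 𝓘(ℝ, E) 𝓘(ℝ, E) ∞ φ.symm}
  one_mem' := ⟨contMDiff_id, contMDiff_id⟩
  mul_mem' := fun hφ hψ => ⟨hφ.1.comp hψ.1, hψ.2.comp hφ.2⟩
  inv_mem' := fun hφ => ⟨hφ.2, hφ.1⟩

variable (E M) in
/-- The group of diffeomorphisms that coincide with the identity outside some compact set. -/
def compactDiff : Subgroup (diffGroup E M) where
  carrier := {φ | ∃ K : Set M, IsCompact K ∧ ∀ p ∉ K, φ.1 p = p}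
  one_mem' := ⟨∅, isCompact_empty, fun _ _ => rfl⟩
  mul_mem' := by
    rintro φ ψ ⟨K, hK, hφ⟩ ⟨L, hL, hψ⟩
    refine ⟨K ∪ L, hK.union hL, fun p hp => ?_⟩
    rw [mem_union, not_or] at hp
    change φ.1 (ψ.1 p) = p
    rw [hψ p hp.2, hφ p hp.1]
  inv_mem' := by
    rintro φ ⟨K, hK, hφ⟩
    refine ⟨K, hK, fun p hp => ?_⟩
    change φ.1.symm p = p
    rw [Equiv.symm_apply_eq, hφ p hp]

/-- The topology of the Lie group of compactly supported diffeomorphisms. This Lie group is modelled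
on the compactly supported vector fields with the inductive limit topology; `X ↦ exp_g ∘ X`, near
`0`, is the inverse of a chart around the identity, and `X ↦ (exp_g ∘ X) ∘ φ` the inverse of a
chart around `φ`. So a set is open if and only if, around each of its elements `φ`, it contains
all elements of the form `(exp_g ∘ X) ∘ φ` with `X` in a neighbourhood of `0`. -/
@[reducible]
def compactDiffTopology (g : RMetric E M) : TopologicalSpace (compactDiff E M) where
  IsOpen V := ∀ φ ∈ V, ∃ U ∈ @nhds _ (compactVFTopology E M) 0, ∀ X ∈ U,
    ∀ ψ : compactDiff E M, IsExpComp g X.1 (ψ * φ⁻¹).1.1 → ψ ∈ V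
  isOpen_univ := fun _ _ => ⟨univ, @univ_mem _ (@nhds _ (compactVFTopology E M) 0),
    fun _ _ _ _ => mem_univ _⟩
  isOpen_inter := by
    rintro V V' hV hV' φ ⟨h, h'⟩
    obtain ⟨U, hU, H⟩ := hV φ h
    obtain ⟨U', hU', H'⟩ := hV' φ h'
    exact ⟨U ∩ U', inter_mem hU hU', fun X hX ψ hψ => ⟨H X hX.1 ψ hψ, H' X hX.2 ψ hψ⟩⟩
  isOpen_sUnion := by
    rintro 𝒱 h𝒱 φ ⟨V, hV, hφ⟩
    obtain ⟨U, hU, H⟩ := h𝒱 V hV φ hφ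
    exact ⟨U, hU, fun X hX ψ hψ => ⟨V, hV, H X hX ψ hψ⟩⟩

/-- The identity component of the group of compactly supported diffeomorphisms. -/
def compactDiffIdComponent (g : RMetric E M) : Set (compactDiff E M) :=
  @connectedComponent _ (compactDiffTopology g) 1

/-- The diffeomorphisms of the form `exp_g ∘ X` with a vector field `X` which is weighted with
respect to the atlas `κ` and the weights `We`, and satisfies `‖X‖_{w, 0} < α` and
`‖X‖_{1, 1} < α`, where these two norms are taken in the charts `κ i` with images restricted to
`V i`. -/
def smallWeightedDiff (g : RMetric E M) {ι : Type*} (κ : ι → OpenPartialHomeomorph M E)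
    (V : ι → Set E) (We : Set (M → WithTop ℝ)) (w : M → ℝ) (α : ℝ) : Set (diffGroup E M) :=
  {φ | ∃ X ∈ weightedVF κ We, vfNorm κ V (fun p => (w p : WithTop ℝ)) 0 X < ENNReal.ofReal α ∧
    vfNorm κ V (fun _ => ((1 : ℝ) : WithTop ℝ)) 1 X < ENNReal.ofReal α ∧ IsExpComp g X φ.1}

/-- The weighted diffeomorphism group: the subgroup of the diffeomorphism group generated by
`D ∩ D⁻¹`, where `D` is the set of small weighted diffeomorphisms. -/
def weightedDiff (g : RMetric E M) {ι : Type*} (κ : ι → OpenPartialHomeomorph M E)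
    (V : ι → Set E) (We : Set (M → WithTop ℝ)) (w : M → ℝ) (α : ℝ) : Subgroup (diffGroup E M) :=
  Subgroup.closure {φ | φ ∈ smallWeightedDiff g κ V We w α ∧
    φ⁻¹ ∈ smallWeightedDiff g κ V We w α}

end Manifold

end WeightedDiffeo

end

/-!
Inclusion of vector fields. The weights in `We` are bounded on compact sets, as they are locally
bounded by weights in `W`. Weights in a maximal extension are then finite, so that saturation with
respect to the atlas, applied to the weight `1`, bounds all derivatives of each coordinate change
on the whole overlap of the two charts (`hasBoundedTransitions`). A vector field with support in a
compact set `K` is therefore controlled, in the finitely many charts that meet `K`, by its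
derivatives on the closed balls of radius `r i`, which cover `M` (`isLocalSeminorm_vfNorm`,
`compactVF_subset_weightedVF`).

Inclusion of groups. A subgroup that contains all compactly supported diffeomorphisms `exp ∘ X`,
with `X` in a neighbourhood of zero, is open and closed, and so contains the identity component
(`compactDiffIdComponent_subset`). Hence it suffices that `ψ = exp ∘ X` and `ψ⁻¹` are both small
weighted diffeomorphisms if `X` is near zero (`exists_nhds_mem_smallWeightedDiff`). For `ψ` this is
the continuity of the seminorms. For `ψ⁻¹`, the geodesics `t ↦ exp (t X p)` are reversed: if
`Y (ψ p)` is the initial velocity of the reversed geodesic, then `ψ⁻¹ = exp ∘ Y`, and it remains to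
see that `Y` is smooth and small in `C¹` in charts (`exists_small_reversal`).

To this end the geodesic equation is solved in a chart, for initial velocities near zero, up to
time `1` and with smooth dependence on the initial values (`exists_shortTimeFlow`); this is the
implicit function theorem for the corresponding integral equation in the Banach space of continuous
maps on `[0, 1]`. As the geodesic spray vanishes to second order in the velocity, the maps `c` and
`y` that take the initial values `(x, v)` to the position and the velocity at time `1` are close in
`C¹` to `(x, v) ↦ x + v` and `(x, v) ↦ v`. In the chart, `ψ` becomes `F x = c (x, X x)`, which is
close to the identity, and `Y` becomes `-Q ∘ F⁻¹` with `Q x = y (x, X x)`, which is close to zero.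

As each compact set meets only finitely many charts, thresholds for `X` can be chosen separately in
each chart and still define a neighbourhood of zero in the inductive limit topology
(`isLocalSeminorm_iSup_ballNorm`).
-/

noncomputable section

namespace WeightedDiffeo

/-! ### Superposition operators on spaces of continuous maps -/

section Superposition

universe u

set_option maxSynthPendingDepth 3

variable {K : Type*} [TopologicalSpace K] [CompactSpace K]
  {E F : Type u} [NormedAddCommGroup E] [NormedSpace ℝ E] [NormedAddCommGroup F] [NormedSpace ℝ F]

/-- Pointwise application of a continuous family of operators to a continuous family of vectors. -/
def pointwiseApply : C(K, E →L[ℝ] F) →L[ℝ] C(K, E) →L[ℝ] C(K, F) :=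
  LinearMap.mkContinuous₂
    (LinearMap.mk₂ ℝ
      (fun (a : C(K, E →L[ℝ] F)) (h : C(K, E)) => (⟨fun t => a t (h t), by fun_prop⟩ : C(K, F)))
      (fun a b h => by ext; simp) (fun c a h => by ext; simp)
      (fun a h k => by ext; simp) (fun c a h => by ext; simp)) 1 (fun a h => by
        rw [one_mul, ContinuousMap.norm_le _ (by positivity)]
        exact fun t => (a t).le_of_opNorm_le_of_le (a.norm_coe_le_norm t) (h.norm_coe_le_norm t))

@[simp]
theorem pointwiseApply_apply (a : C(K, E →L[ℝ] F)) (h : C(K, E)) (t : K) :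
    pointwiseApply a h t = a t (h t) := rfl

/-- The superposition operator `c ↦ f ∘ c` is differentiable. The remainder is estimated by the
mean value inequality, uniformly in the point of `K` because `c ↦ Df ∘ c` is continuous for the
topology of uniform convergence. -/
theorem hasFDerivAt_postcomp (f : C(E, F)) (hf : ContDiff ℝ 1 f) (c : C(K, E)) :
    HasFDerivAt (fun c : C(K, E) => f.comp c)
      (pointwiseApply ((⟨fderiv ℝ f, hf.continuous_fderiv one_ne_zero⟩ : C(E, E →L[ℝ] F)).comp c))
      c := by
  set f' : C(E, E →L[ℝ] F) := ⟨fderiv ℝ f, hf.continuous_fderiv one_ne_zero⟩ with hf'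
  rw [hasFDerivAt_iff_isLittleO_nhds_zero, Asymptotics.isLittleO_iff]
  intro ε hε
  have hcont : Continuous fun c : C(K, E) => f'.comp c := ContinuousMap.continuous_postcomp f'
  obtain ⟨δ, hδ, H⟩ := (Metric.continuousAt_iff (f := fun c : C(K, E) => f'.comp c) (a := c)).1
    hcont.continuousAt ε hε
  filter_upwards [Metric.ball_mem_nhds (0 : C(K, E)) hδ] with h hh
  rw [ContinuousMap.norm_le _ (by positivity)]
  intro t
  have hmv : ∀ y ∈ Metric.ball (c t) δ, ‖fderiv ℝ f y - fderiv ℝ f (c t)‖ ≤ ε := by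
    intro y hy
    have h1 : dist (c + ContinuousMap.const K (y - c t)) c < δ := by
      rw [dist_eq_norm, add_sub_cancel_left]
      refine lt_of_le_of_lt ((ContinuousMap.norm_le _ (norm_nonneg (y - c t))).2 fun s => ?_)
        (mem_ball_iff_norm.1 hy)
      simp
    have h2 := (ContinuousMap.dist_lt_iff hε).1 (H h1) t
    rw [dist_eq_norm] at h2
    simpa [hf'] using h2.le
  have hh' : ‖h‖ < δ := by simpa using hh
  have hmem : c t + h t ∈ Metric.ball (c t) δ := by
    rw [mem_ball_iff_norm, add_sub_cancel_left]
    exact (h.norm_coe_le_norm t).trans_lt hh'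
  have := (convex_ball (c t) δ).norm_image_sub_le_of_norm_hasFDerivWithin_le'
    (f := f) (f' := fderiv ℝ f) (φ := fderiv ℝ f (c t))
    (fun y _ => ((hf.differentiable one_ne_zero) y).hasFDerivAt.hasFDerivWithinAt)
    hmv (Metric.mem_ball_self hδ) hmem
  rw [add_sub_cancel_left] at this
  refine le_trans (le_of_eq ?_)
    (this.trans (mul_le_mul_of_nonneg_left (h.norm_coe_le_norm t) hε.le))
  simp [hf']

/-- The superposition operator with a smooth map is smooth, by induction on the order: its
derivative is the superposition operator with `Df`, followed by a continuous linear map. -/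
theorem contDiff_postcomp (f : C(E, F)) (hf : ContDiff ℝ ∞ f) :
    ContDiff ℝ ∞ (fun c : C(K, E) => f.comp c) := by
  rw [contDiff_infty]
  intro n
  induction n generalizing F with
  | zero => exact contDiff_zero.2 (ContinuousMap.continuous_postcomp f)
  | succ n ih =>
    rw [Nat.cast_add, Nat.cast_one, contDiff_succ_iff_hasFDerivAt]
    have h1 : ContDiff ℝ 1 f := hf.of_le (mod_cast le_top)
    exact ⟨_, pointwiseApply.contDiff.comp (ih ⟨fderiv ℝ f, h1.continuous_fderiv one_ne_zero⟩
      (hf.fderiv_right (m := ∞) (by simp))), hasFDerivAt_postcomp f h1⟩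

end Superposition

/-! ### Integration of curves on the unit interval -/

section Integral

open intervalIntegral

variable {E : Type*} [NormedAddCommGroup E]

theorem continuous_extend (u : C(unitInterval, E)) :
    Continuous fun s : ℝ => u (projIcc 0 1 zero_le_one s) :=
  u.continuous.comp continuous_projIcc

variable [NormedSpace ℝ E]

/-- The primitive `t ↦ ∫₀ᵗ u` of a curve `u` on the unit interval, which is extended to the line by
constants. -/
def primitive (u : C(unitInterval, E)) (t : ℝ) : E :=
  ∫ s in (0 : ℝ)..t, u (projIcc 0 1 zero_le_one s)

theorem hasDerivAt_primitive [CompleteSpace E] (u : C(unitInterval, E)) (t : ℝ) :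
    HasDerivAt (primitive u) (u (projIcc 0 1 zero_le_one t)) t :=
  (continuous_extend u).integral_hasStrictDerivAt 0 t |>.hasDerivAt

@[simp]
theorem primitive_at_zero (u : C(unitInterval, E)) : primitive u 0 = 0 := by simp [primitive]

theorem norm_primitive_le (u : C(unitInterval, E)) {t : ℝ} (ht : t ∈ Icc (0 : ℝ) 1) :
    ‖primitive u t‖ ≤ ‖u‖ := by
  refine (norm_integral_le_of_norm_le_const fun s _ => u.norm_coe_le_norm _).trans ?_
  rw [sub_zero, abs_of_nonneg ht.1]
  exact mul_le_of_le_one_right (norm_nonneg _) ht.2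

/-- Integration of curves as a continuous linear operator. -/
def primitiveL [CompleteSpace E] : C(unitInterval, E) →L[ℝ] C(unitInterval, E) :=
  LinearMap.mkContinuous
    { toFun := fun u => ⟨fun t => primitive u t, by
        have : Continuous (primitive u) :=
          continuous_iff_continuousAt.2 fun t => (hasDerivAt_primitive u t).continuousAt
        exact this.comp continuous_subtype_val⟩
      map_add' := fun u v => by
        ext t
        exact integral_add ((continuous_extend u).intervalIntegrable _ _)
          ((continuous_extend v).intervalIntegrable _ _)
      map_smul' := fun c u => by
        ext t
        exact integral_smul c _ } 1 (fun u => by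
      rw [one_mul, ContinuousMap.norm_le _ (norm_nonneg _)]
      exact fun t => norm_primitive_le u t.2)

@[simp]
theorem primitiveL_apply [CompleteSpace E] (u : C(unitInterval, E)) (t : unitInterval) :
    primitiveL u t = primitive u t := rfl

end Integral

/-! ### Smooth dependence of short solutions of second order equations on initial values -/

/-- The implicit function of a smooth equation is smooth in a whole neighbourhood of the base
point: nearby, it agrees with the implicit functions for other base points. -/
theorem eventually_contDiffAt_implicitFunction
    {E₁ E₂ F : Type*} [NormedAddCommGroup E₁] [NormedSpace ℝ E₁] [CompleteSpace E₁]
    [NormedAddCommGroup E₂] [NormedSpace ℝ E₂] [CompleteSpace E₂]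
    [NormedAddCommGroup F] [NormedSpace ℝ F] [CompleteSpace F]
    {f : E₁ × E₂ → F} (hf : ContDiff ℝ ∞ f) (u : E₁ × E₂) (hn : (∞ : ℕ∞ω) ≠ 0)
    (h : (fderiv ℝ f u ∘L .inr ℝ E₁ E₂).IsInvertible) :
    ∀ᶠ x in 𝓝 u.1, ContDiffAt ℝ ∞ (hf.contDiffAt.implicitFunction hn h) x := by
  have cdf : ContDiffAt ℝ ∞ f u := hf.contDiffAt
  set ψ := hf.contDiffAt.implicitFunction hn h with hψ
  have hcont : ContinuousAt (fun x => (x, ψ x)) u.1 :=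
    continuousAt_id.prodMk (cdf.hasStrictFDerivAt_implicitFunction hn h).continuousAt
  have hu : (u.1, ψ u.1) = u := by rw [hψ, cdf.implicitFunction_apply_self hn h]
  have hinv : ∀ᶠ v in 𝓝 u, (fderiv ℝ f v ∘L .inr ℝ E₁ E₂).IsInvertible := by
    have hc : Continuous fun v => fderiv ℝ f v ∘L .inr ℝ E₁ E₂ :=
      (hf.continuous_fderiv (by simp)).clm_comp continuous_const
    obtain ⟨e, he⟩ := h
    have h0 : {A : E₂ →L[ℝ] F | A.IsInvertible} ∈ 𝓝 (fderiv ℝ f u ∘L .inr ℝ E₁ E₂) := by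
      rw [← he]
      exact e.nhds
    exact hc.continuousAt h0
  have hmem : ∀ᶠ x in 𝓝 u.1, ∀ᶠ v in 𝓝 (x, ψ x), f v = f u ↔ ψ v.1 = v.2 :=
    (by simpa only [ContinuousAt, hu] using hcont :
      Tendsto (fun x => (x, ψ x)) (𝓝 u.1) (𝓝 u)).eventually
      (cdf.eventually_apply_eq_iff_implicitFunction hn h).eventually_nhds
  have hmem' : ∀ᶠ x in 𝓝 u.1, (fderiv ℝ f (x, ψ x) ∘L .inr ℝ E₁ E₂).IsInvertible :=
    (by simpa only [ContinuousAt, hu] using hcont :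
      Tendsto (fun x => (x, ψ x)) (𝓝 u.1) (𝓝 u)).eventually hinv
  filter_upwards [hmem, hmem', cdf.eventually_apply_implicitFunction hn h] with x h1 h2 h3
  have cdx : ContDiffAt ℝ ∞ f (x, ψ x) := hf.contDiffAt
  have hx : ContDiffAt ℝ ∞ (cdx.implicitFunction hn h2) x := cdx.contDiffAt_implicitFunction hn h2
  refine hx.congr_of_eventuallyEq ?_
  have hxc : Tendsto (fun y => (y, cdx.implicitFunction hn h2 y)) (𝓝 x) (𝓝 (x, ψ x)) := by
    have h4 : cdx.implicitFunction hn h2 x = ψ x := cdx.implicitFunction_apply_self hn h2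
    have := continuousAt_id.prodMk hx.continuousAt
    simpa only [ContinuousAt, id, h4] using this
  filter_upwards [hxc.eventually h1, cdx.eventually_apply_implicitFunction hn h2] with y h5 h6
  exact h5.1 (h6.trans h3)

section Flow

universe u

variable {E : Type u} [NormedAddCommGroup E] [NormedSpace ℝ E]

/-- The velocity curve `t ↦ v + ∫₀ᵗ u` with initial velocity `v` and acceleration `u`, as a linear
function of `((z, v), u)`. -/
def velocityL [CompleteSpace E] : (E × E) × C(unitInterval, E) →L[ℝ] C(unitInterval, E) :=
  (ContinuousLinearMap.const ℝ unitInterval).comp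
    ((ContinuousLinearMap.snd ℝ E E).comp (ContinuousLinearMap.fst ℝ _ _)) +
  primitiveL.comp (ContinuousLinearMap.snd ℝ _ _)

/-- The position curve with initial position `z`, initial velocity `v` and acceleration `u`, as a
linear function of `((z, v), u)`. -/
def positionL [CompleteSpace E] : (E × E) × C(unitInterval, E) →L[ℝ] C(unitInterval, E) :=
  (ContinuousLinearMap.const ℝ unitInterval).comp
    ((ContinuousLinearMap.fst ℝ E E).comp (ContinuousLinearMap.fst ℝ _ _)) +
  primitiveL.comp velocityL

/-- The curve of positions and velocities. -/
def stateL [CompleteSpace E] : (E × E) × C(unitInterval, E) →L[ℝ] C(unitInterval, E × E) :=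
  ((ContinuousLinearMap.inl ℝ E E).compLeftContinuous ℝ unitInterval).comp positionL +
  ((ContinuousLinearMap.inr ℝ E E).compLeftContinuous ℝ unitInterval).comp velocityL

theorem velocityL_apply [CompleteSpace E] (p : E × E) (u : C(unitInterval, E)) (t : unitInterval) :
    velocityL (p, u) t = p.2 + primitive u t := rfl

theorem positionL_apply [CompleteSpace E] (p : E × E) (u : C(unitInterval, E)) (t : unitInterval) :
    positionL (p, u) t = p.1 + primitive (velocityL (p, u)) t := rfl

theorem stateL_apply [CompleteSpace E] (q : (E × E) × C(unitInterval, E)) (t : unitInterval) :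
    stateL q t = (positionL q t, velocityL q t) := by
  simp [stateL]

theorem primitive_zero (t : ℝ) : primitive (0 : C(unitInterval, E)) t = 0 := by
  simp [primitive]

theorem stateL_const [CompleteSpace E] (z : E) :
    stateL ((z, 0), (0 : C(unitInterval, E))) = ContinuousMap.const _ (z, 0) := by
  have h : velocityL ((z, 0), (0 : C(unitInterval, E))) = 0 := by
    ext t; simp [velocityL_apply, primitive_zero]
  ext t
  · simp [stateL_apply, positionL_apply, h, primitive_zero]
  · simp [stateL_apply, h]

/-- A function which is smooth near a point agrees near this point with a globally smooth one,
namely with its product with a bump function. -/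
theorem exists_contDiff_eventuallyEq [FiniteDimensional ℝ E] {F : Type*} [NormedAddCommGroup F]
    [NormedSpace ℝ F] {f : E → F} {O : Set E} (hO : IsOpen O) (hf : ContDiffOn ℝ ∞ f O) {a : E}
    (ha : a ∈ O) :
    ∃ f' : E → F, ContDiff ℝ ∞ f' ∧ f' =ᶠ[𝓝 a] f ∧ ∀ x, x ∉ O ∨ f x = 0 → f' x = 0 := by
  obtain ⟨ρ, hρ, hsub⟩ := Metric.nhds_basis_closedBall.mem_iff.1 (hO.mem_nhds ha)
  let χ : ContDiffBump a := ⟨ρ / 2, ρ, by positivity, by linarith⟩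
  refine ⟨fun x => χ x • f x, ?_, ?_, ?_⟩
  · rw [contDiff_iff_contDiffAt]
    intro x
    by_cases hx : x ∈ O
    · exact χ.contDiff.contDiffAt.smul (hf.contDiffAt (hO.mem_nhds hx))
    · have hx' : x ∉ tsupport χ := by
        rw [χ.tsupport_eq]
        exact fun h => hx (hsub h)
      refine (contDiffAt_const (c := (0 : F))).congr_of_eventuallyEq ?_
      filter_upwards [notMem_tsupport_iff_eventuallyEq.1 hx'] with y hy
      simp [hy]
  · filter_upwards [χ.eventuallyEq_one] with y hy
    simp [hy]
  · rintro x (hx | hx)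
    · have : χ x = 0 := image_eq_zero_of_notMem_tsupport (by
        rw [χ.tsupport_eq]
        exact fun h => hx (hsub h))
      simp [this]
    · simp [hx]

set_option maxSynthPendingDepth 3 in
/-- Solutions on `[0, 1]` of the second order equation `c'' = S (c, c')` with small initial
velocity. As `S` vanishes to second order at velocity `0`, the acceleration `u` of the solution with
initial values `(z, v)` solves `u = S (z + t v + ∫∫ u, v + ∫ u)`, whose linearization in `u` at
`((z₀, 0), 0)` is the identity; so the implicit function theorem in the space of continuous curves
applies, and the derivative of `(z, v) ↦ u` at `(z₀, 0)` is zero. -/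
theorem exists_shortTimeFlow [FiniteDimensional ℝ E] {S : E × E → E} {U : Set E} (hU : IsOpen U)
    (hS : ContDiffOn ℝ ∞ S (U ×ˢ univ)) (hS0 : ∀ x ∈ U, S (x, 0) = 0) {z₀ : E} (hz₀ : z₀ ∈ U)
    (hS' : fderiv ℝ S (z₀, 0) = 0) {N : Set E} (hN : N ∈ 𝓝 z₀) {ε : ℝ} (hε : 0 < ε) :
    ∃ η > 0, ∃ c y : E × E → ℝ → E, ∀ p ∈ Metric.ball z₀ η ×ˢ Metric.ball (0 : E) η,
      (c p 0 = p.1 ∧ y p 0 = p.2) ∧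
      (∀ t ∈ Icc (0 : ℝ) 1, c p t ∈ U ∩ N ∧ HasDerivAt (c p) (y p t) t ∧
        HasDerivAt (y p) (S (c p t, y p t)) t) ∧
      (ContDiffAt ℝ ∞ (fun q => c q 1) p ∧ ContDiffAt ℝ ∞ (fun q => y q 1) p) ∧
      ‖fderiv ℝ (fun q => c q 1) p - (.fst ℝ E E + .snd ℝ E E)‖ ≤ ε ∧
      ‖fderiv ℝ (fun q => y q 1) p - .snd ℝ E E‖ ≤ ε ∧ ‖y p 1‖ ≤ ε ∧ (p.2 = 0 → y p 1 = 0) := by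
  have : CompleteSpace E := FiniteDimensional.complete ℝ E
  obtain ⟨S', hS's, hSS', hS'0⟩ := exists_contDiff_eventuallyEq (hU.prod isOpen_univ) hS
    (a := (z₀, 0)) ⟨hz₀, mem_univ _⟩
  have hS'z : ∀ z, S' (z, 0) = 0 := fun z => hS'0 _ (by
    by_cases hz : z ∈ U
    · exact Or.inr (hS0 z hz)
    · exact Or.inl fun h => hz h.1)
  have hS'd : fderiv ℝ S' (z₀, 0) = 0 := by rw [hSS'.fderiv_eq, hS']
  let Sc : C(E × E, E) := ⟨S', hS's.continuous⟩
  let Ψ : (E × E) × C(unitInterval, E) → C(unitInterval, E) := fun q => q.2 - Sc.comp (stateL q)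
  have hst : ContDiff ℝ ∞ (stateL (E := E)) := ContinuousLinearMap.contDiff _
  have hΨ : ContDiff ℝ ∞ Ψ := contDiff_snd.sub ((contDiff_postcomp Sc hS's).comp hst)
  have hΨ0 : ∀ z, Ψ ((z, 0), 0) = 0 := fun z => by
    ext t
    simp [Ψ, stateL_const, Sc, hS'z]
  set u₀ : (E × E) × C(unitInterval, E) := ((z₀, 0), 0) with hu₀
  have hΨd : fderiv ℝ Ψ u₀ = .snd ℝ _ _ := by
    have h1 := hasFDerivAt_postcomp Sc (hS's.of_le (mod_cast le_top)) (stateL u₀)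
    have hst' : HasFDerivAt (stateL (E := E)) stateL u₀ := ContinuousLinearMap.hasFDerivAt _
    have h2 : HasFDerivAt Ψ _ u₀ := hasFDerivAt_snd.sub (h1.comp u₀ hst')
    rw [h2.fderiv, sub_eq_self, hu₀, stateL_const]
    refine ContinuousLinearMap.ext fun q => ?_
    ext t
    simp [Sc, hS'd]
  have hinv : (fderiv ℝ Ψ u₀ ∘L .inr ℝ (E × E) C(unitInterval, E)).IsInvertible := by
    rw [hΨd, ContinuousLinearMap.snd_comp_inr]
    exact ⟨ContinuousLinearEquiv.refl ℝ _, rfl⟩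
  have hn : (∞ : ℕ∞ω) ≠ 0 := by simp
  set ψ := hΨ.contDiffAt.implicitFunction hn hinv with hψ
  have hψs := eventually_contDiffAt_implicitFunction hΨ u₀ hn hinv
  have hψ0 : ψ (z₀, 0) = 0 := hΨ.contDiffAt.implicitFunction_apply_self hn hinv
  have hψd : HasFDerivAt ψ (0 : E × E →L[ℝ] C(unitInterval, E)) (z₀, 0) := by
    have h := (hΨ.contDiffAt.hasStrictFDerivAt_implicitFunction hn hinv).hasFDerivAt
    rw [← hψ] at h
    convert! h
    rw [hΨd, ContinuousLinearMap.snd_comp_inl, ContinuousLinearMap.comp_zero, neg_zero]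
  have hΨu₀ : Ψ u₀ = 0 := hΨ0 z₀
  have hgraph : HasFDerivAt (fun p => (p, ψ p)) ((ContinuousLinearMap.id ℝ (E × E)).prod 0)
      (z₀, 0) := (hasFDerivAt_id _).prodMk hψd
  let c : E × E → ℝ → E := fun p t => p.1 + primitive (velocityL (p, ψ p)) t
  let y : E × E → ℝ → E := fun p t => p.2 + primitive (ψ p) t
  let ev : C(unitInterval, E) →L[ℝ] E := ContinuousMap.evalCLM ℝ 1
  have hc1 : (fun p => c p 1) = fun p => (ev ∘L positionL) (p, ψ p) := rfl
  have hy1 : (fun p => y p 1) = fun p => (ev ∘L velocityL) (p, ψ p) := rfl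
  have hcs : ∀ p, ContDiffAt ℝ ∞ ψ p → ContDiffAt ℝ ∞ (fun q => c q 1) p := fun p hp => by
    rw [hc1]
    exact (ev ∘L positionL).contDiff.contDiffAt.comp p (contDiffAt_id.prodMk hp)
  have hys : ∀ p, ContDiffAt ℝ ∞ ψ p → ContDiffAt ℝ ∞ (fun q => y q 1) p := fun p hp => by
    rw [hy1]
    exact (ev ∘L velocityL).contDiff.contDiffAt.comp p (contDiffAt_id.prodMk hp)
  have hcd : fderiv ℝ (fun q => c q 1) (z₀, 0) = .fst ℝ E E + .snd ℝ E E := by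
    refine (((ev ∘L positionL).hasFDerivAt.comp (z₀, (0 : E)) hgraph).fderiv).trans
      (ContinuousLinearMap.ext fun q => ?_)
    simp [ev, positionL, velocityL, primitive]
  have hyd : fderiv ℝ (fun q => y q 1) (z₀, 0) = .snd ℝ E E := by
    refine (((ev ∘L velocityL).hasFDerivAt.comp (z₀, (0 : E)) hgraph).fderiv).trans
      (ContinuousLinearMap.ext fun q => ?_)
    simp [ev, velocityL]
  have hclose : ∀ {f : E × E → E} {A : E × E →L[ℝ] E}, ContDiffAt ℝ ∞ f (z₀, 0) →
      fderiv ℝ f (z₀, 0) = A → ∀ᶠ p in 𝓝 ((z₀, 0) : E × E), ‖fderiv ℝ f p - A‖ ≤ ε := by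
    intro f A hf hA
    have h := (hf.fderiv_right (m := ∞) (by simp)).continuousAt
    filter_upwards [Metric.continuousAt_iff'.1 h ε hε] with p hp
    rw [dist_eq_norm, hA] at hp
    exact hp.le
  have hO : ∀ᶠ x in 𝓝 ((z₀, 0) : E × E), S' x = S x ∧ x.1 ∈ U ∩ N :=
    hSS'.and (continuousAt_fst.preimage_mem_nhds (inter_mem (hU.mem_nhds hz₀) hN))
  obtain ⟨ρ, hρ, hball⟩ := Metric.mem_nhds_iff.1 hO
  have hstate : ∀ᶠ p in 𝓝 ((z₀, 0) : E × E), ∀ t, stateL (p, ψ p) t ∈ Metric.ball (z₀, 0) ρ := by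
    have h : ContinuousAt (fun p => stateL (p, ψ p)) (z₀, 0) :=
      hst.continuous.continuousAt.comp hgraph.continuousAt
    filter_upwards [Metric.continuousAt_iff'.1 h ρ hρ] with p hp t
    have := (ContinuousMap.dist_apply_le_dist t).trans_lt hp
    rwa [hψ0, stateL_const] at this
  have hzero : ∀ᶠ p in 𝓝 ((z₀, 0) : E × E), p.2 = 0 → ψ p = 0 := by
    have h : Tendsto (fun p : E × E => (p, (0 : C(unitInterval, E)))) (𝓝 (z₀, 0)) (𝓝 u₀) :=
      (continuous_id.prodMk continuous_const).tendsto _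
    filter_upwards [h.eventually (hΨ.contDiffAt.eventually_apply_eq_iff_implicitFunction hn hinv)]
      with p hp hp2
    refine hp.1 ?_
    rw [hΨu₀]
    obtain ⟨z, v⟩ := p
    obtain rfl : v = 0 := hp2
    exact hΨ0 z
  have hsmall : ∀ᶠ p in 𝓝 ((z₀, 0) : E × E), ‖y p 1‖ ≤ ε := by
    have h := (hys _ hψs.self_of_nhds).continuousAt
    have h0 : y (z₀, 0) 1 = 0 := by simp [y, hψ0, primitive_zero]
    filter_upwards [Metric.continuousAt_iff'.1 h ε hε] with p hp
    rw [h0, dist_zero_right] at hp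
    exact hp.le
  have hall := hψs.and <| (hΨ.contDiffAt.eventually_apply_implicitFunction hn hinv).and <|
    hstate.and <| (hclose (hcs _ hψs.self_of_nhds) hcd).and <|
    (hclose (hys _ hψs.self_of_nhds) hyd).and <| hsmall.and hzero
  obtain ⟨η, hη, H⟩ := Metric.mem_nhds_iff.1 hall
  refine ⟨η, hη, c, y, fun p hp => ?_⟩
  rw [ball_prod_same] at hp
  obtain ⟨h1, h2, h3, h4, h5, h6, h7⟩ := H hp
  refine ⟨by simp [c, y], fun t ht => ?_, ⟨hcs p h1, hys p h1⟩, h4, h5, h6, fun hp2 => ?_⟩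
  · have hproj : projIcc 0 1 zero_le_one t = ⟨t, ht⟩ := projIcc_of_mem _ ht
    have hs : stateL (p, ψ p) ⟨t, ht⟩ = (c p t, y p t) := by
      rw [stateL_apply]; rfl
    have h3t := hball (h3 ⟨t, ht⟩)
    rw [hs] at h3t
    refine ⟨h3t.2, ?_, ?_⟩
    · have := (hasDerivAt_primitive (velocityL (p, ψ p)) t).const_add p.1
      rw [hproj] at this
      exact this
    · have := (hasDerivAt_primitive (ψ p) t).const_add p.2
      rw [hproj] at this
      have h8 : ψ p ⟨t, ht⟩ = S (c p t, y p t) := by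
        rw [← h3t.1, ← hs]
        have := DFunLike.congr_fun (h2.trans hΨu₀) (⟨t, ht⟩ : unitInterval)
        exact sub_eq_zero.1 this
      rw [h8] at this
      exact this
  · simp [y, h7 hp2, hp2, primitive_zero]

end Flow

/-! ### Vector fields and metrics in charts -/

section Charts

variable {E : Type*} [NormedAddCommGroup E] [NormedSpace ℝ E]
  {M : Type*} [TopologicalSpace M] [ChartedSpace E M]

theorem mdifferentiable_of_mem_maximalAtlas {κ : OpenPartialHomeomorph M E}
    (hκ : κ ∈ IsManifold.maximalAtlas 𝓘(ℝ, E) ∞ M) : κ.MDifferentiable 𝓘(ℝ, E) 𝓘(ℝ, E) :=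
  ⟨(contMDiffOn_of_mem_maximalAtlas hκ).mdifferentiableOn (by simp),
    (contMDiffOn_symm_of_mem_maximalAtlas hκ).mdifferentiableOn (by simp)⟩

theorem contDiffOn_transition {κ κ' : OpenPartialHomeomorph M E}
    (hκ : κ ∈ IsManifold.maximalAtlas 𝓘(ℝ, E) ∞ M)
    (hκ' : κ' ∈ IsManifold.maximalAtlas 𝓘(ℝ, E) ∞ M) :
    ContDiffOn ℝ ∞ (κ ∘ κ'.symm) (κ'.symm ≫ₕ κ).source := by
  rw [← contMDiffOn_iff_contDiffOn, OpenPartialHomeomorph.trans_source]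
  exact (contMDiffOn_of_mem_maximalAtlas hκ).comp
    ((contMDiffOn_symm_of_mem_maximalAtlas hκ').mono inter_subset_left) fun x hx => hx.2

theorem mfderiv_symm_mfderiv {κ : OpenPartialHomeomorph M E}
    (hκ : κ ∈ IsManifold.maximalAtlas 𝓘(ℝ, E) ∞ M) {p : M} (hp : p ∈ κ.source)
    (v : TangentSpace 𝓘(ℝ, E) p) :
    mfderiv 𝓘(ℝ, E) 𝓘(ℝ, E) κ.symm (κ p) (mfderiv 𝓘(ℝ, E) 𝓘(ℝ, E) κ p v) = v :=
  DFunLike.congr_fun ((mdifferentiable_of_mem_maximalAtlas hκ).symm_comp_deriv hp) v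

theorem isInvertible_mfderiv {κ : OpenPartialHomeomorph M E}
    (hκ : κ ∈ IsManifold.maximalAtlas 𝓘(ℝ, E) ∞ M) {p : M} (hp : p ∈ κ.source) :
    (mfderiv 𝓘(ℝ, E) 𝓘(ℝ, E) κ p).IsInvertible :=
  ⟨(mdifferentiable_of_mem_maximalAtlas hκ).mfderiv hp, rfl⟩

variable [IsManifold 𝓘(ℝ, E) ∞ M]

theorem vfLoc_apply (X : VF E M) (κ : OpenPartialHomeomorph M E) {p : M} (hp : p ∈ κ.source) :
    vfLoc X κ (κ p) = mfderiv 𝓘(ℝ, E) 𝓘(ℝ, E) κ p (X p) := by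
  unfold vfLoc
  rw [κ.left_inv hp]

/-- The transformation law of vector fields under a change of charts. -/
theorem vfLoc_transition (X : VF E M) {κ κ' : OpenPartialHomeomorph M E}
    (hκ : κ ∈ IsManifold.maximalAtlas 𝓘(ℝ, E) ∞ M)
    (hκ' : κ' ∈ IsManifold.maximalAtlas 𝓘(ℝ, E) ∞ M) {x : E} (hx : x ∈ (κ'.symm ≫ₕ κ).source) :
    vfLoc X κ (κ (κ'.symm x)) = fderiv ℝ (κ ∘ κ'.symm) x (vfLoc X κ' x) := by
  rw [OpenPartialHomeomorph.trans_source] at hx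
  have h := mdifferentiable_of_mem_maximalAtlas hκ
  have h' := mdifferentiable_of_mem_maximalAtlas hκ'
  have hc := mfderiv_comp x (h.mdifferentiableAt hx.2) (h'.mdifferentiableAt_symm hx.1)
  have hp : κ'.symm x ∈ κ'.source := κ'.map_target hx.1
  have h1 := mfderiv_symm_mfderiv hκ' hp (X (κ'.symm x))
  rw [κ'.right_inv hx.1] at h1
  rw [vfLoc_apply X κ hx.2, ← mfderiv_eq_fderiv, hc]
  exact (congrArg (mfderiv 𝓘(ℝ, E) 𝓘(ℝ, E) κ (κ'.symm x)) h1).symm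

theorem contDiffOn_vfLoc (X : VF E M) {κ : OpenPartialHomeomorph M E}
    (hκ : κ ∈ IsManifold.maximalAtlas 𝓘(ℝ, E) ∞ M) : ContDiffOn ℝ ∞ (vfLoc X κ) κ.target := by
  have h1 : ContMDiffOn 𝓘(ℝ, E).tangent 𝓘(ℝ, E).tangent ∞
      (tangentMapWithin 𝓘(ℝ, E) 𝓘(ℝ, E) κ κ.source) (π E (TangentSpace 𝓘(ℝ, E)) ⁻¹' κ.source) :=
    (contMDiffOn_of_mem_maximalAtlas hκ).contMDiffOn_tangentMapWithin (by simp)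
      κ.open_source.uniqueMDiffOn
  have h2 : ContMDiffOn 𝓘(ℝ, E) 𝓘(ℝ, E).tangent ∞
      (fun x => (⟨κ.symm x, X (κ.symm x)⟩ : TangentBundle 𝓘(ℝ, E) M)) κ.target :=
    X.contMDiff.comp_contMDiffOn (contMDiffOn_symm_of_mem_maximalAtlas hκ)
  have h3 := h1.comp h2 fun x hx => κ.map_target hx
  refine (((contMDiff_snd_tangentBundle_modelSpace E 𝓘(ℝ, E)).comp_contMDiffOn
    h3).contDiffOn).congr fun x hx => ?_
  have := mfderivWithin_of_isOpen (I := 𝓘(ℝ, E)) (I' := 𝓘(ℝ, E)) (f := κ)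
    κ.open_source (κ.map_target hx)
  simp only [Function.comp, tangentMapWithin, this, vfLoc]
  rfl

/-- A vector field which is smooth in suitable charts is smooth. -/
theorem contMDiff_of_forall_exists_chart [CompleteSpace E] (Y : ∀ p : M, TangentSpace 𝓘(ℝ, E) p)
    (h : ∀ p, ∃ κ ∈ IsManifold.maximalAtlas 𝓘(ℝ, E) ∞ M, p ∈ κ.source ∧
      ContDiffAt ℝ ∞
        (fun x => (mfderiv 𝓘(ℝ, E) 𝓘(ℝ, E) κ (κ.symm x) (Y (κ.symm x)) : E)) (κ p)) :
    ContMDiff 𝓘(ℝ, E) (𝓘(ℝ, E).prod 𝓘(ℝ, E)) ∞ fun p => TotalSpace.mk' E p (Y p) := by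
  intro p
  obtain ⟨κ, hκ, hp, hc⟩ := h p
  have h1 := contMDiffAt_vectorSpace_iff_contDiffAt
    (V := fun x => (mfderiv 𝓘(ℝ, E) 𝓘(ℝ, E) κ (κ.symm x) (Y (κ.symm x)) : E)).2 hc
  have h2 := h1.mpullback_vectorField_preimage (contMDiffAt_of_mem_maximalAtlas hκ hp)
    (isInvertible_mfderiv hκ hp) (by simp)
  refine h2.congr_of_eventuallyEq ?_
  filter_upwards [κ.open_source.mem_nhds hp] with q hq
  have h3 : ∀ q', q' = q → (mfderiv 𝓘(ℝ, E) 𝓘(ℝ, E) κ q).inverse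
      (mfderiv 𝓘(ℝ, E) 𝓘(ℝ, E) κ q' (Y q') : E) = Y q := by
    rintro _ rfl
    exact (isInvertible_mfderiv hκ hq).inverse_apply_eq.2 rfl
  exact congrArg (TotalSpace.mk' E q) (h3 _ (κ.left_inv hq)).symm

theorem contDiffOn_localMetric [FiniteDimensional ℝ E] (g : RMetric E M)
    {κ : OpenPartialHomeomorph M E} (hκ : κ ∈ IsManifold.maximalAtlas 𝓘(ℝ, E) ∞ M) :
    ContDiffOn ℝ ∞ (localMetric g κ) κ.target := by
  rw [contDiffOn_clm_apply]
  intro v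
  rw [contDiffOn_clm_apply]
  intro w
  have hvec : ∀ v : E, ContMDiffOn 𝓘(ℝ, E) 𝓘(ℝ, E).tangent ∞
      (fun x => TotalSpace.mk' E (E := (TangentSpace 𝓘(ℝ, E) : M → Type _)) (κ.symm x)
        (mfderiv 𝓘(ℝ, E) 𝓘(ℝ, E) κ.symm x v)) κ.target := by
    intro v
    have h1 : ContMDiffOn 𝓘(ℝ, E).tangent 𝓘(ℝ, E).tangent ∞
        (tangentMapWithin 𝓘(ℝ, E) 𝓘(ℝ, E) κ.symm κ.target)
        (π E (TangentSpace 𝓘(ℝ, E)) ⁻¹' κ.target) :=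
      (contMDiffOn_symm_of_mem_maximalAtlas hκ).contMDiffOn_tangentMapWithin (by simp)
        κ.open_target.uniqueMDiffOn
    have h2 := contMDiffOn_vectorSpace_iff_contDiffOn (V := fun _ => v).2
      (contDiffOn_const (s := κ.target) (n := ∞) (𝕜 := ℝ) (E := E))
    refine (h1.comp h2 fun x hx => hx).congr fun x hx => ?_
    have := mfderivWithin_of_isOpen (I := 𝓘(ℝ, E)) (I' := 𝓘(ℝ, E)) (f := κ.symm) κ.open_target hx
    simp only [Function.comp, tangentMapWithin, this]
  rw [← contMDiffOn_iff_contDiffOn]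
  intro x hx
  have h1 : ContMDiffWithinAt 𝓘(ℝ, E) (𝓘(ℝ, E).prod 𝓘(ℝ)) ∞
      (fun m ↦ TotalSpace.mk' ℝ (E := Bundle.Trivial M ℝ) (κ.symm m) (g.inner (κ.symm m)
        (mfderiv 𝓘(ℝ, E) 𝓘(ℝ, E) κ.symm m v) (mfderiv 𝓘(ℝ, E) 𝓘(ℝ, E) κ.symm m w)))
      κ.target x := by
    apply ContMDiffWithinAt.clm_bundle_apply₂ (F₁ := E) (F₂ := E)
    · exact g.contMDiff.contMDiffAt.comp_contMDiffWithinAt x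
        (contMDiffOn_symm_of_mem_maximalAtlas hκ x hx)
    · exact hvec v x hx
    · exact hvec w x hx
  simp only [contMDiffWithinAt_totalSpace] at h1
  exact h1.2

theorem localMetric_pos (g : RMetric E M)
    {κ : OpenPartialHomeomorph M E} (hκ : κ ∈ IsManifold.maximalAtlas 𝓘(ℝ, E) ∞ M) {x : E}
    (hx : x ∈ κ.target) {v : E} (hv : v ≠ 0) : 0 < localMetric g κ x v v := by
  refine g.pos (κ.symm x) (mfderiv 𝓘(ℝ, E) 𝓘(ℝ, E) κ.symm x v) fun h => hv ?_
  have h1 := (mdifferentiable_of_mem_maximalAtlas hκ).symm.mfderiv_injective (x := x) hx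
  exact h1 (h.trans (map_zero _).symm)

end Charts

/-! ### Weights -/

section Weights

theorem wabs_coe (x : ℝ) : wabs (x : WithTop ℝ) = ENNReal.ofReal |x| := rfl

theorem wabs_one : wabs ((1 : ℝ) : WithTop ℝ) = 1 := by
  rw [wabs_coe, abs_one, ENNReal.ofReal_one]

/-- Weights in the maximal extension of a set of locally bounded weights are finite: this is seen by
testing the defining estimate on a bump function. -/
theorem wabs_lt_top_of_mem_maxExt {ι E : Type*} [NormedAddCommGroup E] [NormedSpace ℝ E]
    [FiniteDimensional ℝ E] {S : ι → Set E} (hS : ∀ i, IsOpen (S i))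
    {W : Set (ι → E → WithTop ℝ)}
    (hW : ∀ h ∈ W, ∀ i, ∀ L ⊆ S i, IsCompact L → ∃ C : ℝ≥0, ∀ x ∈ L, wabs (h i x) ≤ C)
    {f : ι → E → WithTop ℝ} (hf : f ∈ maxExt S W) {i : ι} {x : E} (hx : x ∈ S i) :
    wabs (f i x) < ⊤ := by
  classical
  have : ProperSpace E := FiniteDimensional.proper ℝ E
  -- a tent function around `x` on `S i`, extended by zero to the other components
  obtain ⟨ρ, hρ, hsub⟩ := Metric.nhds_basis_closedBall.mem_iff.1 ((hS i).mem_nhds hx)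
  let b : E → ℝ := fun y => max 0 (1 - dist y x / ρ)
  have hb0 : ∀ y, y ∉ Metric.closedBall x ρ → b y = 0 := fun y hy => by
    refine max_eq_left ?_
    rw [Metric.mem_closedBall, not_le] at hy
    rw [sub_nonpos, le_div_iff₀ hρ, one_mul]
    exact hy.le
  have hb1 : ∀ y, ‖b y‖ₑ ≤ 1 := fun y => by
    rw [Real.enorm_eq_ofReal (le_max_left _ _), ENNReal.ofReal_le_one]
    refine max_le zero_le_one ?_
    have := div_nonneg (dist_nonneg (x := y) (y := x)) hρ.le
    linarith
  have hbx : b x = 1 := by simp [b]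
  let φ : ι → E → ℝ := Pi.single i b
  have hφi : φ i = b := Pi.single_eq_same _ _
  have hφj : ∀ j, j ≠ i → φ j = 0 := fun j hj => Pi.single_eq_of_ne hj _
  obtain ⟨F, C, hF, H⟩ := hf (fun _ => ℝ)
  have hfin : ∀ h ∈ W, supNormFam S h φ < ⊤ := by
    intro h hh
    obtain ⟨B, hB⟩ := hW h hh i _ hsub (isCompact_closedBall x ρ)
    refine lt_of_le_of_lt (iSup_le fun j => iSup₂_le fun y hy => ?_) (ENNReal.coe_lt_top (r := B))
    by_cases hj : j = i
    · subst hj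
      rw [hφi]
      by_cases hyb : y ∈ Metric.closedBall x ρ
      · exact (mul_le_mul' (hB y hyb) (hb1 y)).trans_eq (mul_one _)
      · simp [hb0 y hyb]
    · simp [hφj j hj]
  have h1 := H φ (fun j => by
    by_cases hj : j = i
    · subst hj
      rw [hφi]
      fun_prop
    · rw [hφj j hj]
      exact continuousOn_const) hfin
  have h2 : wabs (f i x) ≤ supNormFam S f φ := by
    refine le_trans ?_ (le_iSup_of_le i (le_iSup₂_of_le x hx le_rfl))
    simp [hφi, hbx]
  refine (h2.trans h1).trans_lt (ENNReal.mul_lt_top ENNReal.coe_lt_top ?_)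
  exact ENNReal.sum_lt_top.2 fun h hh => hfin h (hF hh)

/-- Locally `W`-bounded weights are bounded on compact sets if those in `W` are. -/
theorem exists_wabs_le_of_isCompact {M : Type*} [TopologicalSpace M] {W : Set (M → ℝ)}
    (hbdd : ∀ f ∈ W, ∀ K : Set M, IsCompact K → ∃ C : ℝ, ∀ p ∈ K, |f p| ≤ C)
    {We : Set (M → WithTop ℝ)}
    (hloc : LocallyBoundedBy ((fun f p => ((f p : ℝ) : WithTop ℝ)) '' W) We)
    {h : M → WithTop ℝ} (hh : h ∈ We) {K : Set M} (hK : IsCompact K) :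
    ∃ C : ℝ≥0, ∀ p ∈ K, wabs (h p) ≤ C := by
  obtain ⟨_, ⟨f, hf, rfl⟩, H⟩ := hloc h hh
  obtain ⟨B, hB⟩ := hbdd f hf K hK
  -- repeating the condition `p ∈ K` admits neighbourhoods in `M` in the induction on compact sets
  suffices ∃ C : ℝ≥0, ∀ p ∈ K, p ∈ K → wabs (h p) ≤ C by
    obtain ⟨C, hC⟩ := this
    exact ⟨C, fun p hp => hC p hp hp⟩
  refine hK.induction_on (p := fun s => ∃ C : ℝ≥0, ∀ p ∈ s, p ∈ K → wabs (h p) ≤ C)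
    ⟨0, by simp⟩ ?_ ?_ ?_
  · rintro s t hst ⟨C, hC⟩
    exact ⟨C, fun p hp => hC p (hst hp)⟩
  · rintro s t ⟨C, hC⟩ ⟨D, hD⟩
    refine ⟨max C D, fun p hp hpK => ?_⟩
    rcases hp with hp | hp
    · exact (hC p hp hpK).trans (by exact_mod_cast le_max_left C D)
    · exact (hD p hp hpK).trans (by exact_mod_cast le_max_right C D)
  · intro x _
    obtain ⟨U, hU, c, _, hc⟩ := H x
    refine ⟨U, mem_nhdsWithin_of_mem_nhds hU, c * B.toNNReal, fun p hp hpK => ?_⟩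
    refine (hc p hp).trans ?_
    rw [ENNReal.coe_mul, wabs_coe]
    exact mul_le_mul_right (ENNReal.ofReal_le_ofReal (hB p hpK)) _

end Weights

/-! ### Bounds for coordinate changes -/

section Transition

variable {E : Type*} [NormedAddCommGroup E] [NormedSpace ℝ E]
  {M : Type*} [TopologicalSpace M]

/-- All derivatives of positive order of the coordinate changes between charts of `κ` are bounded
on the whole overlap of the charts. -/
def HasBoundedTransitions {ι : Type*} (κ : ι → OpenPartialHomeomorph M E) : Prop :=
  ∀ i j, ∀ n : ℕ, ∃ C : ℝ, ∀ x ∈ ((κ j).symm ≫ₕ κ i).source, ∀ l, 1 ≤ l → l ≤ n →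
    ‖iteratedFDeriv ℝ l (κ i ∘ (κ j).symm) x‖ ≤ C

/-- As `1` is a weight and all weights are finite, saturation with respect to the atlas bounds
the coordinate changes. -/
theorem hasBoundedTransitions [FiniteDimensional ℝ E] {ι : Type*}
    {κ : ι → OpenPartialHomeomorph M E}
    {We : Set (M → WithTop ℝ)} (hone : (fun _ => ((1 : ℝ) : WithTop ℝ)) ∈ We)
    (hbd : ∀ h ∈ We, ∀ K, IsCompact K → ∃ C : ℝ≥0, ∀ p ∈ K, wabs (h p) ≤ C)
    (hsat : IsSaturatedTransition κ We) : HasBoundedTransitions κ := by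
  have key : ∀ i j (l : ℕ), ∃ C : ℝ, ∀ x ∈ ((κ j).symm ≫ₕ κ i).source,
      ‖iteratedFDeriv ℝ (l + 1) (κ i ∘ (κ j).symm) x‖ ≤ C := by
    intro i j l
    rcases ((κ j).symm ≫ₕ κ i).source.eq_empty_or_nonempty with he | ⟨x₀, hx₀⟩
    · exact ⟨0, fun x hx => absurd hx (he ▸ notMem_empty x)⟩
    obtain ⟨h, hh, H⟩ := hsat (weightLoc (fun q : ι × ι => κ q.2) fun _ => ((1 : ℝ) : WithTop ℝ))
      (mem_image_of_mem _ hone) l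
    have h1 : wabs (h (i, j) x₀) < ⊤ := by
      refine wabs_lt_top_of_mem_maxExt (S := fun q : ι × ι => ((κ q.2).symm ≫ₕ κ q.1).source)
        (i := (i, j)) (fun q => ((κ q.2).symm ≫ₕ κ q.1).open_source) ?_ hh hx₀
      rintro _ ⟨f, hf, rfl⟩ q L hL hLc
      obtain ⟨C, hC⟩ := hbd f hf ((κ q.2).symm '' L) (hLc.image_of_continuousOn
        ((κ q.2).symm.continuousOn.mono fun x hx => by
          have := hL hx
          rw [OpenPartialHomeomorph.trans_source] at this
          exact this.1))
      exact ⟨C, fun x hx => hC _ (mem_image_of_mem _ hx)⟩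
    have h2 := (H (i, j) x₀ hx₀).trans_lt h1
    simp only [weightLoc, wabs_one, mul_one] at h2
    refine ⟨(wnorm ((κ j).symm ≫ₕ κ i).source (fun _ => 1) l
      (fderiv ℝ (κ i ∘ (κ j).symm))).toReal, fun x hx => ?_⟩
    rw [← norm_iteratedFDeriv_fderiv, ← toReal_enorm]
    refine ENNReal.toReal_mono h2.ne ?_
    refine le_trans ?_ (le_iSup₂_of_le (f := fun x _ => 1 *
      ‖iteratedFDeriv ℝ l (fderiv ℝ (κ i ∘ (κ j).symm)) x‖ₑ) x hx le_rfl)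
    rw [one_mul]
  intro i j n
  choose C hC using key i j
  refine ⟨∑ l ∈ Finset.range n, |C l|, fun x hx l hl hln => ?_⟩
  obtain ⟨l, rfl⟩ := Nat.exists_eq_add_of_le' hl
  exact ((hC l x hx).trans (le_abs_self _)).trans
    (Finset.single_le_sum (f := fun l => |C l|) (fun _ _ => abs_nonneg _)
      (Finset.mem_range.2 (by omega)))

variable [ChartedSpace E M] [IsManifold 𝓘(ℝ, E) ∞ M]

/-- The derivatives up to order `n` of a vector field in one chart bound those in another one, with
constants that only depend on the coordinate changes `τ` and `σ = τ⁻¹` between the charts: the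
localizations are related by `X_κ = (Dτ · X_κ') ∘ σ`. -/
theorem norm_iteratedFDeriv_vfLoc_le (X : VF E M) {κ κ' : OpenPartialHomeomorph M E}
    (hκ : κ ∈ IsManifold.maximalAtlas 𝓘(ℝ, E) ∞ M)
    (hκ' : κ' ∈ IsManifold.maximalAtlas 𝓘(ℝ, E) ∞ M) {p : M} (hp : p ∈ κ.source)
    (hp' : p ∈ κ'.source) (n : ℕ) {D : ℝ} (hD : 1 ≤ D)
    (h : ∀ l, 1 ≤ l → l ≤ n + 1 → ‖iteratedFDeriv ℝ l (κ ∘ κ'.symm) (κ' p)‖ ≤ D)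
    (h' : ∀ l, 1 ≤ l → l ≤ n → ‖iteratedFDeriv ℝ l (κ' ∘ κ.symm) (κ p)‖ ≤ D) :
    ‖iteratedFDeriv ℝ n (vfLoc X κ) (κ p)‖ ≤ n.factorial * (2 ^ n * D) * D ^ n *
      ∑ l ∈ Finset.range (n + 1), ‖iteratedFDeriv ℝ l (vfLoc X κ') (κ' p)‖ := by
  set σ := κ' ∘ κ.symm with hσ
  set τ := κ ∘ κ'.symm with hτ
  set A := (κ.symm ≫ₕ κ').source with hA
  set A' := (κ'.symm ≫ₕ κ).source with hA'
  have hAo : IsOpen A := (κ.symm ≫ₕ κ').open_source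
  have hAo' : IsOpen A' := (κ'.symm ≫ₕ κ).open_source
  have hpA : κ p ∈ A := by
    rw [hA, OpenPartialHomeomorph.trans_source]
    exact ⟨κ.map_source hp, by simpa [κ.left_inv hp] using hp'⟩
  have hpA' : κ' p ∈ A' := by
    rw [hA', OpenPartialHomeomorph.trans_source]
    exact ⟨κ'.map_source hp', by simpa [κ'.left_inv hp'] using hp⟩
  have hσp : σ (κ p) = κ' p := by simp [hσ, κ.left_inv hp]
  have hmaps : MapsTo σ A A' := fun x hx => by
    rw [hA, OpenPartialHomeomorph.trans_source] at hx
    rw [hA', OpenPartialHomeomorph.trans_source]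
    refine ⟨κ'.map_source hx.2, ?_⟩
    have h1 : κ'.symm (κ' (κ.symm x)) = κ.symm x := κ'.left_inv hx.2
    rw [mem_preimage, hσ, Function.comp_apply, h1]
    exact κ.map_target hx.1
  have hτs : ContDiffOn ℝ ∞ τ A' := contDiffOn_transition hκ hκ'
  have hσs : ContDiffOn ℝ ∞ σ A := contDiffOn_transition hκ' hκ
  have hXs : ContDiffOn ℝ ∞ (vfLoc X κ') A' := (contDiffOn_vfLoc X hκ').mono fun x hx => by
    rw [hA', OpenPartialHomeomorph.trans_source] at hx
    exact hx.1
  have hτ's : ContDiffOn ℝ ∞ (fderiv ℝ τ) A' := hτs.fderiv_of_isOpen hAo' (by simp)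
  set s := ∑ l ∈ Finset.range (n + 1), ‖iteratedFDeriv ℝ l (vfLoc X κ') (κ' p)‖ with hs
  have hs0 : 0 ≤ s := Finset.sum_nonneg fun _ _ => norm_nonneg _
  set H : E → E := fun y => fderiv ℝ τ y (vfLoc X κ' y) with hH
  have hHs : ContDiffOn ℝ ∞ H A' := hτ's.clm_apply hXs
  have hXH : EqOn (vfLoc X κ) (H ∘ σ) A := fun x hx => by
    have hx' := hmaps hx
    have h1 := vfLoc_transition X hκ hκ' hx'
    rw [hA, OpenPartialHomeomorph.trans_source] at hx
    have h2 : κ (κ'.symm (σ x)) = x := by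
      have h3 : κ'.symm (κ' (κ.symm x)) = κ.symm x := κ'.left_inv hx.2
      rw [hσ, Function.comp_apply, h3, κ.right_inv hx.1]
    rw [h2] at h1
    exact h1
  have hHb : ∀ i ≤ n, ‖iteratedFDerivWithin ℝ i H A' (σ (κ p))‖ ≤ 2 ^ n * D * s := by
    intro i hi
    rw [hσp]
    have h1 := norm_iteratedFDerivWithin_clm_apply hτ's hXs hAo'.uniqueDiffOn hpA' (n := i)
      (mod_cast le_top)
    refine h1.trans ?_
    have h2 : ∀ k ∈ Finset.range (i + 1),
        (i.choose k : ℝ) * ‖iteratedFDerivWithin ℝ k (fderiv ℝ τ) A' (κ' p)‖ *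
          ‖iteratedFDerivWithin ℝ (i - k) (vfLoc X κ') A' (κ' p)‖ ≤ i.choose k * (D * s) := by
      intro k hk
      rw [Finset.mem_range] at hk
      rw [iteratedFDerivWithin_of_isOpen k hAo' hpA',
        iteratedFDerivWithin_of_isOpen (i - k) hAo' hpA', norm_iteratedFDeriv_fderiv, mul_assoc]
      refine mul_le_mul_of_nonneg_left (mul_le_mul (h _ (by omega) (by omega)) ?_
        (norm_nonneg _) (by positivity)) (by positivity)
      exact Finset.single_le_sum (f := fun l => ‖iteratedFDeriv ℝ l (vfLoc X κ') (κ' p)‖)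
        (fun _ _ => norm_nonneg _) (Finset.mem_range.2 (by omega))
    refine (Finset.sum_le_sum h2).trans ?_
    rw [← Finset.sum_mul, mul_assoc]
    refine mul_le_mul_of_nonneg_right ?_ (by positivity)
    have h3 : ((∑ k ∈ Finset.range (i + 1), i.choose k : ℕ) : ℝ) = 2 ^ i := by
      rw [Nat.sum_range_choose]; push_cast; ring
    rw [← Nat.cast_sum, h3]
    exact pow_le_pow_right₀ one_le_two hi
  have hσb : ∀ i, 1 ≤ i → i ≤ n → ‖iteratedFDerivWithin ℝ i σ A (κ p)‖ ≤ D ^ i := by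
    intro i hi hin
    rw [iteratedFDerivWithin_of_isOpen i hAo hpA]
    exact (h' i hi hin).trans (le_self_pow₀ hD (by omega))
  have h4 := norm_iteratedFDerivWithin_comp_le hHs hσs (mod_cast le_top) hAo'.uniqueDiffOn
    hAo.uniqueDiffOn hmaps hpA hHb hσb
  rw [iteratedFDerivWithin_congr hXH.symm hpA, iteratedFDerivWithin_of_isOpen n hAo hpA] at h4
  refine h4.trans (le_of_eq (by ring))

theorem HasBoundedTransitions.exists_norm_iteratedFDeriv_le {ι : Type*}
    {κ : ι → OpenPartialHomeomorph M E} (hκ : ∀ i, κ i ∈ IsManifold.maximalAtlas 𝓘(ℝ, E) ∞ M)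
    (h : HasBoundedTransitions κ) (i j : ι) (n : ℕ) :
    ∃ C : ℝ≥0, ∀ X : VF E M, ∀ p ∈ (κ i).source, p ∈ (κ j).source →
      ‖iteratedFDeriv ℝ n (vfLoc X (κ j)) (κ j p)‖ₑ ≤
        C * ∑ l ∈ Finset.range (n + 1), ‖iteratedFDeriv ℝ l (vfLoc X (κ i)) (κ i p)‖ₑ := by
  obtain ⟨C₁, h₁⟩ := h i j (n + 1)
  obtain ⟨C₂, h₂⟩ := h j i (n + 1)
  set D := max 1 (max C₁ C₂) with hD
  have hD1 : 1 ≤ D := le_max_left _ _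
  have hD0 : 0 ≤ D := zero_le_one.trans hD1
  set C := n.factorial * (2 ^ n * D) * D ^ n with hC
  have hC0 : 0 ≤ C := by positivity
  refine ⟨C.toNNReal, fun X p hp hp' => ?_⟩
  have hm : κ i p ∈ ((κ i).symm ≫ₕ κ j).source := by
    rw [OpenPartialHomeomorph.trans_source]
    exact ⟨(κ i).map_source hp, by simpa [(κ i).left_inv hp] using hp'⟩
  have hm' : κ j p ∈ ((κ j).symm ≫ₕ κ i).source := by
    rw [OpenPartialHomeomorph.trans_source]
    exact ⟨(κ j).map_source hp', by simpa [(κ j).left_inv hp'] using hp⟩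
  have := norm_iteratedFDeriv_vfLoc_le X (hκ j) (hκ i) hp' hp n hD1
    (fun l hl hl' => (h₂ _ hm l hl hl').trans ((le_max_right _ _).trans (le_max_right _ _)))
    (fun l hl hl' => (h₁ _ hm' l hl (by omega)).trans ((le_max_left _ _).trans (le_max_right _ _)))
  simp only [← ofReal_norm]
  rw [← ENNReal.ofReal_sum_of_nonneg fun _ _ => norm_nonneg _]
  exact (ENNReal.ofReal_le_ofReal this).trans_eq (ENNReal.ofReal_mul hC0)

end Transition

/-! ### Seminorms on compactly supported vector fields -/

section Seminorms

theorem wnorm_mono {E F : Type*} [NormedAddCommGroup E] [NormedSpace ℝ E] [NormedAddCommGroup F]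
    [NormedSpace ℝ F] {S T : Set E} (h : S ⊆ T) (f : E → ℝ≥0∞) (ℓ : ℕ) (φ : E → F) :
    wnorm S f ℓ φ ≤ wnorm T f ℓ φ :=
  biSup_mono fun _ hx => h hx

theorem le_wnorm_one {E F : Type*} [NormedAddCommGroup E] [NormedSpace ℝ E] [NormedAddCommGroup F]
    [NormedSpace ℝ F] {S : Set E} (ℓ : ℕ) (φ : E → F) {x : E} (hx : x ∈ S) :
    ‖iteratedFDeriv ℝ ℓ φ x‖ₑ ≤ wnorm S (fun _ => 1) ℓ φ := by
  unfold wnorm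
  simp only [one_mul]
  exact le_iSup₂_of_le (f := fun x _ => ‖iteratedFDeriv ℝ ℓ φ x‖ₑ) x hx le_rfl

variable {E : Type*} [NormedAddCommGroup E] [NormedSpace ℝ E]
  {M : Type*} [TopologicalSpace M] [ChartedSpace E M] [IsManifold 𝓘(ℝ, E) ∞ M]

theorem vfLoc_add (X Y : VF E M) (κ : OpenPartialHomeomorph M E) :
    vfLoc (X + Y) κ = vfLoc X κ + vfLoc Y κ := by
  ext x
  exact map_add (mfderiv 𝓘(ℝ, E) 𝓘(ℝ, E) κ (κ.symm x)) _ _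

theorem vfLoc_smul (c : ℝ) (X : VF E M) (κ : OpenPartialHomeomorph M E) :
    vfLoc (c • X) κ = c • vfLoc X κ := by
  ext x
  exact map_smul (mfderiv 𝓘(ℝ, E) 𝓘(ℝ, E) κ (κ.symm x)) c _

theorem iteratedFDeriv_vfLoc_add (X Y : VF E M) {κ : OpenPartialHomeomorph M E}
    (hκ : κ ∈ IsManifold.maximalAtlas 𝓘(ℝ, E) ∞ M) (ℓ : ℕ) {x : E} (hx : x ∈ κ.target) :
    iteratedFDeriv ℝ ℓ (vfLoc (X + Y) κ) x =
      iteratedFDeriv ℝ ℓ (vfLoc X κ) x + iteratedFDeriv ℝ ℓ (vfLoc Y κ) x := by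
  have h : ∀ Z : VF E M, ContDiffAt ℝ ℓ (vfLoc Z κ) x := fun Z =>
    ((contDiffOn_vfLoc Z hκ).contDiffAt (κ.open_target.mem_nhds hx)).of_le (mod_cast le_top)
  rw [vfLoc_add, iteratedFDeriv_add_apply (h X) (h Y)]

theorem iteratedFDeriv_vfLoc_smul (c : ℝ) (X : VF E M) {κ : OpenPartialHomeomorph M E}
    (hκ : κ ∈ IsManifold.maximalAtlas 𝓘(ℝ, E) ∞ M) (ℓ : ℕ) {x : E} (hx : x ∈ κ.target) :
    iteratedFDeriv ℝ ℓ (vfLoc (c • X) κ) x = c • iteratedFDeriv ℝ ℓ (vfLoc X κ) x := by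
  have h : ContDiffAt ℝ ℓ (vfLoc X κ) x :=
    ((contDiffOn_vfLoc X hκ).contDiffAt (κ.open_target.mem_nhds hx)).of_le (mod_cast le_top)
  rw [vfLoc_smul]
  exact iteratedFDeriv_const_smul_apply h

theorem wnorm_vfLoc_add_le (X Y : VF E M) {κ : OpenPartialHomeomorph M E}
    (hκ : κ ∈ IsManifold.maximalAtlas 𝓘(ℝ, E) ∞ M) {S : Set E} (hS : S ⊆ κ.target)
    (f : E → ℝ≥0∞) (ℓ : ℕ) :
    wnorm S f ℓ (vfLoc (X + Y) κ) ≤ wnorm S f ℓ (vfLoc X κ) + wnorm S f ℓ (vfLoc Y κ) := by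
  refine iSup₂_le fun x hx => ?_
  rw [iteratedFDeriv_vfLoc_add X Y hκ ℓ (hS hx)]
  refine (mul_le_mul_right (enorm_add_le (iteratedFDeriv ℝ ℓ (vfLoc X κ) x) _) _).trans ?_
  rw [mul_add]
  exact add_le_add (le_iSup₂_of_le (f := fun x _ => f x * ‖iteratedFDeriv ℝ ℓ (vfLoc X κ) x‖ₑ)
      x hx le_rfl)
    (le_iSup₂_of_le (f := fun x _ => f x * ‖iteratedFDeriv ℝ ℓ (vfLoc Y κ) x‖ₑ) x hx le_rfl)

theorem wnorm_vfLoc_smul (c : ℝ) (X : VF E M) {κ : OpenPartialHomeomorph M E}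
    (hκ : κ ∈ IsManifold.maximalAtlas 𝓘(ℝ, E) ∞ M) {S : Set E} (hS : S ⊆ κ.target)
    (f : E → ℝ≥0∞) (ℓ : ℕ) :
    wnorm S f ℓ (vfLoc (c • X) κ) = ‖c‖ₑ * wnorm S f ℓ (vfLoc X κ) := by
  unfold wnorm
  simp only [ENNReal.mul_iSup]
  refine iSup_congr fun x => iSup_congr fun hx => ?_
  rw [iteratedFDeriv_vfLoc_smul c X hκ ℓ (hS hx), enorm_smul, mul_left_comm]

/-- A vector field with support in a compact set has compactly supported localizations. -/
theorem iteratedFDeriv_vfLoc_eq_zero [T2Space M] {X : VF E M} {K : Set M} (hK : IsCompact K)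
    (hX : ∀ p ∉ K, X p = 0) {κ : OpenPartialHomeomorph M E} (ℓ : ℕ) {x : E} (hx : x ∈ κ.target)
    (hxK : κ.symm x ∉ K) : iteratedFDeriv ℝ ℓ (vfLoc X κ) x = 0 := by
  have h : vfLoc X κ =ᶠ[𝓝 x] fun _ => 0 := by
    filter_upwards [(κ.symm.continuousAt hx).preimage_mem_nhds
      (hK.isClosed.isOpen_compl.mem_nhds hxK)] with y hy
    rw [vfLoc, hX _ hy, map_zero]
    rfl
  rw [(h.iteratedFDeriv ℝ ℓ).eq_of_nhds]
  exact congrFun iteratedFDeriv_fun_zero x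

theorem wnorm_vfLoc_lt_top (X : VF E M) {κ : OpenPartialHomeomorph M E}
    (hκ : κ ∈ IsManifold.maximalAtlas 𝓘(ℝ, E) ∞ M) {L : Set E} (hL : IsCompact L)
    (hLκ : L ⊆ κ.target) (ℓ : ℕ) : wnorm L (fun _ => 1) ℓ (vfLoc X κ) < ⊤ := by
  have hc : ContinuousOn (iteratedFDeriv ℝ ℓ (vfLoc X κ)) L := fun x hx => by
    have h := ((contDiffOn_vfLoc X hκ).contDiffAt (κ.open_target.mem_nhds (hLκ hx)))
    exact (h.iteratedFDeriv_right (m := 0) (i := ℓ)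
      (by simpa using mod_cast le_top)).continuousAt.continuousWithinAt
  obtain ⟨C, hC⟩ := hL.exists_bound_of_continuousOn hc
  refine lt_of_le_of_lt (iSup₂_le fun x hx => ?_) (ENNReal.ofReal_lt_top (r := C))
  rw [one_mul, ← ofReal_norm]
  exact ENNReal.ofReal_le_ofReal (hC x hx)

variable {ι : Type*} (κ : ι → OpenPartialHomeomorph M E) (r : ι → ℝ)

/-- The sum of the seminorms `‖·‖_{1, l}`, `l ≤ ℓ`, of the localization on the closed ball of
radius `r i`. -/
def ballNorm (i : ι) (ℓ : ℕ) (X : VF E M) : ℝ≥0∞ :=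
  ∑ l ∈ Finset.range (ℓ + 1), wnorm (Metric.closedBall 0 (r i)) (fun _ => 1) l (vfLoc X (κ i))

/-- An extended seminorm on vector fields which is controlled, on vector fields with support in a
given compact set, by finitely many of the seminorms `ballNorm`. -/
structure IsLocalSeminorm (N : VF E M → ℝ≥0∞) : Prop where
  add_le : ∀ X Y, N (X + Y) ≤ N X + N Y
  smul_eq : ∀ (c : ℝ) X, N (c • X) = ‖c‖ₑ * N X
  bound : ∀ K : Set M, IsCompact K → ∃ (F : Finset ι) (ℓ : ℕ) (C : ℝ≥0), ∀ X : VF E M,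
    (∀ p ∉ K, X p = 0) → N X ≤ C * ∑ i ∈ F, ballNorm κ r i ℓ X

variable {κ r}

theorem ballNorm_lt_top [FiniteDimensional ℝ E]
    (hκ : ∀ i, κ i ∈ IsManifold.maximalAtlas 𝓘(ℝ, E) ∞ M)
    (hr : ∀ i, Metric.closedBall 0 (r i) ⊆ (κ i).target) (i : ι) (ℓ : ℕ) (X : VF E M) :
    ballNorm κ r i ℓ X < ⊤ :=
  have : ProperSpace E := FiniteDimensional.proper ℝ E
  ENNReal.sum_lt_top.2 fun l _ =>
    wnorm_vfLoc_lt_top X (hκ i) (isCompact_closedBall _ _) (hr i) l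

theorem IsLocalSeminorm.lt_top [FiniteDimensional ℝ E]
    (hκ : ∀ i, κ i ∈ IsManifold.maximalAtlas 𝓘(ℝ, E) ∞ M)
    (hr : ∀ i, Metric.closedBall 0 (r i) ⊆ (κ i).target)
    {N : VF E M → ℝ≥0∞} (hN : IsLocalSeminorm κ r N) (X : compactVF E M) : N X.1 < ⊤ := by
  obtain ⟨K, hK, hX⟩ := X.2
  obtain ⟨F, ℓ, C, h⟩ := hN.bound K hK
  exact (h X.1 hX).trans_lt (ENNReal.mul_lt_top ENNReal.coe_lt_top
    (ENNReal.sum_lt_top.2 fun i _ => ballNorm_lt_top hκ hr i ℓ X.1))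

/-- Extended seminorms with local bounds give rise to neighbourhoods of zero in the inductive limit
topology, and, more generally, to open sets. -/
theorem IsLocalSeminorm.isOpen [FiniteDimensional ℝ E]
    (hκ : ∀ i, κ i ∈ IsManifold.maximalAtlas 𝓘(ℝ, E) ∞ M)
    (hr : ∀ i, Metric.closedBall 0 (r i) ⊆ (κ i).target)
    {N : VF E M → ℝ≥0∞} (hN : IsLocalSeminorm κ r N) (X₀ : VF E M)
    (hX₀ : ∀ X : compactVF E M, N (X.1 - X₀) < ⊤) (e : ℝ≥0∞) :
    IsOpen[compactVFTopology E M] {X : compactVF E M | N (X.1 - X₀) < e} := by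
  have : ProperSpace E := FiniteDimensional.proper ℝ E
  let := compactVFTopology E M
  have hfin := hN.lt_top hκ hr
  let p : Seminorm ℝ (compactVF E M) := Seminorm.of (fun X => (N X.1).toReal)
    (fun X Y => by
      rw [← ENNReal.toReal_add (hfin X).ne (hfin Y).ne]
      exact ENNReal.toReal_mono (ENNReal.add_ne_top.2 ⟨(hfin X).ne, (hfin Y).ne⟩)
        (hN.add_le X.1 Y.1))
    (fun c X => by
      change (N (c • X.1)).toReal = _
      rw [hN.smul_eq, ENNReal.toReal_mul, toReal_enorm])
  have hp : ∀ X : compactVF E M, ENNReal.ofReal (p X) = N X.1 := fun X =>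
    ENNReal.ofReal_toReal (hfin X).ne
  have hLF : IsLFSeminorm p := by
    intro K hK
    obtain ⟨F, ℓ, C, h⟩ := hN.bound K hK
    let J := F ×ˢ Finset.range (ℓ + 1)
    let q : Fin J.card → ι × ℕ := fun k => (J.equivFin.symm k : ι × ℕ)
    refine ⟨J.card, fun k => κ (q k).1, fun k => Metric.closedBall 0 (r (q k).1),
      fun k => (q k).2, C, fun k => ⟨hκ _, isCompact_closedBall _ _, hr _⟩, fun X hX => ?_⟩
    rw [hp]
    refine (h X.1 hX).trans (le_of_eq ?_)
    congr 1
    unfold ballNorm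
    rw [← Finset.sum_product', ← Finset.sum_coe_sort J]
    exact Fintype.sum_equiv J.equivFin _ _ fun z => by simp [q]
  rw [isOpen_iff_forall_mem_open]
  intro X hX
  rw [mem_ofPred_eq] at hX
  -- a radius `d` with `N (X - X₀) + d ≤ e`
  obtain ⟨d, hd0, hd⟩ : ∃ d : ℝ, 0 < d ∧ N (X.1 - X₀) + ENNReal.ofReal d ≤ e := by
    obtain ⟨d, hd0, hd⟩ := ENNReal.lt_iff_exists_add_pos_lt.1 hX
    exact ⟨d, hd0, by rw [ENNReal.ofReal_coe_nnreal]; exact hd.le⟩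
  refine ⟨{Y | p (Y - X) < d}, fun Y hY => ?_,
    TopologicalSpace.isOpen_generateFrom_of_mem ⟨p, hLF, X, d, hd0, rfl⟩, ?_⟩
  · have h1 : N (Y.1 - X.1) < ENNReal.ofReal d := by
      have := hp (Y - X)
      rw [Submodule.coe_sub] at this
      rw [← this]
      exact (ENNReal.ofReal_lt_ofReal_iff hd0).2 hY
    have h2 : N (Y.1 - X₀) ≤ N (Y.1 - X.1) + N (X.1 - X₀) := by
      have := hN.add_le (Y.1 - X.1) (X.1 - X₀)
      rwa [sub_add_sub_cancel] at this
    refine (h2.trans_lt ?_).trans_le hd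
    rw [add_comm]
    exact ENNReal.add_lt_add_left (hX₀ X).ne h1
  · rw [mem_ofPred_eq, sub_self, map_zero]
    exact hd0

end Seminorms

section Inclusion

variable {E : Type*} [NormedAddCommGroup E] [NormedSpace ℝ E]
  {M : Type*} [TopologicalSpace M] [ChartedSpace E M] [IsManifold 𝓘(ℝ, E) ∞ M]
  {ι : Type*} {κ : ι → OpenPartialHomeomorph M E} {r : ι → ℝ}

/-- The weighted norms on vector fields are local seminorms. In a chart meeting a compact set `K`,
the derivatives of a vector field with support in `K` are bounded by those on the
closed balls in the finitely many charts that meet `K`. -/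
theorem isLocalSeminorm_vfNorm [T2Space M] (hκ : IsLocallyFiniteAtlas κ)
    (hκr : ∀ p : M, ∃ i, p ∈ (κ i).source ∧ κ i p ∈ Metric.ball (0 : E) (r i))
    (hbt : HasBoundedTransitions κ) {f : M → WithTop ℝ}
    (hf : ∀ K, IsCompact K → ∃ C : ℝ≥0, ∀ p ∈ K, wabs (f p) ≤ C) (ℓ : ℕ) :
    IsLocalSeminorm κ r (vfNorm κ (fun i => (κ i).target) f ℓ) where
  add_le X Y := iSup_le fun i =>
    (wnorm_vfLoc_add_le X Y (hκ.mem_maximalAtlas i) Subset.rfl _ ℓ).trans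
      (add_le_add (le_iSup_of_le i le_rfl) (le_iSup_of_le i le_rfl))
  smul_eq c X := by
    unfold vfNorm
    rw [ENNReal.mul_iSup]
    exact iSup_congr fun i => wnorm_vfLoc_smul c X (hκ.mem_maximalAtlas i) Subset.rfl _ ℓ
  bound K hK := by
    obtain ⟨B, hB⟩ := hf K hK
    have hfin := hκ.locallyFinite.finite_nonempty_inter_compact hK
    choose C hC using fun i j => hbt.exists_norm_iteratedFDeriv_le hκ.mem_maximalAtlas i j ℓ
    set F := hfin.toFinset with hF
    refine ⟨F, ℓ, B * ∑ i ∈ F, ∑ j ∈ F, C i j, fun X hX => iSup_le fun j => iSup₂_le fun x hx => ?_⟩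
    by_cases hxK : (κ j).symm x ∈ K
    · obtain ⟨i, hi, hir⟩ := hκr ((κ j).symm x)
      have hiF : i ∈ F := hfin.mem_toFinset.2 ⟨_, hi, hxK⟩
      have hjF : j ∈ F := hfin.mem_toFinset.2 ⟨_, (κ j).map_target hx, hxK⟩
      have h1 := hC i j X _ hi ((κ j).map_target hx)
      rw [(κ j).right_inv hx] at h1
      rw [ENNReal.coe_mul, mul_assoc]
      refine mul_le_mul' (hB _ hxK) (h1.trans (mul_le_mul' ?_ ?_))
      · rw [ENNReal.coe_le_coe]
        exact (Finset.single_le_sum (f := fun j => C i j) (fun _ _ => zero_le) hjF).trans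
          (Finset.single_le_sum (f := fun i => ∑ j ∈ F, C i j) (fun _ _ => zero_le) hiF)
      · refine le_trans ?_ (Finset.single_le_sum (f := fun i => ballNorm κ r i ℓ X)
          (fun _ _ => zero_le) hiF)
        exact Finset.sum_le_sum fun l _ => le_wnorm_one l _ (Metric.ball_subset_closedBall hir)
    · rw [← ofReal_norm, iteratedFDeriv_vfLoc_eq_zero hK hX ℓ hx hxK, norm_zero,
        ENNReal.ofReal_zero, mul_zero]
      exact zero_le

/-- Compactly supported vector fields are weighted vector fields, with continuous inclusion. -/
theorem compactVF_subset_weightedVF [FiniteDimensional ℝ E] [T2Space M]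
    (hκ : IsLocallyFiniteAtlas κ)
    (hκr : ∀ p : M, ∃ i, p ∈ (κ i).source ∧ κ i p ∈ Metric.ball (0 : E) (r i))
    (hr : ∀ i, Metric.closedBall 0 (r i) ⊆ (κ i).target)
    (hbt : HasBoundedTransitions κ) {We : Set (M → WithTop ℝ)}
    (hWe : ∀ f ∈ We, ∀ K, IsCompact K → ∃ C : ℝ≥0, ∀ p ∈ K, wabs (f p) ≤ C) :
    ∃ hsub : ∀ X : compactVF E M, X.1 ∈ weightedVF κ We,
      Continuous[compactVFTopology E M, weightedVFTopology κ We] fun X => ⟨X.1, hsub X⟩ := by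
  have hN : ∀ f ∈ We, ∀ ℓ, IsLocalSeminorm κ r (vfNorm κ (fun i => (κ i).target) f ℓ) :=
    fun f hf ℓ => isLocalSeminorm_vfNorm hκ hκr hbt (hWe f hf) ℓ
  have hsub : ∀ X : compactVF E M, X.1 ∈ weightedVF κ We := fun X f hf ℓ =>
    (hN f hf ℓ).lt_top hκ.mem_maximalAtlas hr X
  refine ⟨hsub, continuous_generateFrom_iff.2 ?_⟩
  rintro _ ⟨f, hf, ℓ, X₀, e, -, rfl⟩
  refine (hN f hf ℓ).isOpen hκ.mem_maximalAtlas hr X₀.1 (fun X => ?_) e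
  have h1 := (hN f hf ℓ).add_le X.1 ((-1 : ℝ) • X₀.1)
  rw [(hN f hf ℓ).smul_eq, neg_one_smul, ← sub_eq_add_neg] at h1
  exact h1.trans_lt (ENNReal.add_lt_top.2 ⟨hsub X f hf ℓ, by simpa using X₀.2 f hf ℓ⟩)

end Inclusion

/-! ### The geodesic spray in a chart -/

section Spray

set_option maxSynthPendingDepth 3

variable {E : Type*} [NormedAddCommGroup E] [NormedSpace ℝ E]

/-- For a trilinear form `T`, the map `(v, v') ↦ T v v' · - T · v v' / 2`. For the derivative of the
metric, its values on the diagonal are the first order term of the geodesic equation; its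
symmetrization in `v` and `v'` gives the Christoffel symbols of the first kind. -/
def christoffelForm (T : E →L[ℝ] E →L[ℝ] E →L[ℝ] ℝ) : E →L[ℝ] E →L[ℝ] E →L[ℝ] ℝ :=
  T - (1 / 2 : ℝ) •
    (ContinuousLinearMap.flipₗᵢ ℝ E E ℝ).toContinuousLinearEquiv.toContinuousLinearMap.comp
      (ContinuousLinearMap.flipₗᵢ ℝ E E (E →L[ℝ] ℝ) T)

theorem christoffelForm_apply (T : E →L[ℝ] E →L[ℝ] E →L[ℝ] ℝ) (v v' w : E) :
    christoffelForm T v v' w = T v v' w - (1 / 2 : ℝ) * T w v v' := rfl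

theorem contDiff_christoffelForm : ContDiff ℝ ∞ (christoffelForm (E := E)) :=
  contDiff_id.sub (((contDiff_const).clm_comp
    (ContinuousLinearMap.flipₗᵢ ℝ E E (E →L[ℝ] ℝ)).contDiff).const_smul _)

/-- The operator `v' ↦ -G⁻¹ (Γ (v, v'))` at `(x, v)`, where `Γ` is the `christoffelForm` of the
derivative of the metric tensor `G` at `x`. -/
def sprayOp (G : E → E →L[ℝ] E →L[ℝ] ℝ) (z : E × E) : E →L[ℝ] E :=
  -((G z.1).inverse ∘L christoffelForm (fderiv ℝ G z.1) z.2)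

/-- The acceleration of the geodesic of the metric tensor `G` with position and velocity `z`. -/
def spray (G : E → E →L[ℝ] E →L[ℝ] ℝ) (z : E × E) : E := sprayOp G z z.2

theorem sprayOp_zero (G : E → E →L[ℝ] E →L[ℝ] ℝ) (x : E) : sprayOp G (x, 0) = 0 := by
  simp [sprayOp]

theorem spray_zero (G : E → E →L[ℝ] E →L[ℝ] ℝ) (x : E) : spray G (x, 0) = 0 := map_zero _

/-- The geodesic equation is invariant under the reversal `t ↦ 1 - t` of curves. -/
theorem GeodesicEqAt.reverse {G : E → E →L[ℝ] E →L[ℝ] ℝ} {x : ℝ → E} {t : ℝ}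
    (h : GeodesicEqAt G x (1 - t)) : GeodesicEqAt G (fun s => x (1 - s)) t := by
  have hd : deriv (fun s => x (1 - s)) = fun s => -deriv x (1 - s) := by
    ext s
    exact deriv_comp_const_sub x 1 s
  have hc : ContinuousAt (fun s : ℝ => 1 - s) t := by fun_prop
  have hdiff : DifferentiableAt ℝ (fun s => deriv x (1 - s)) t :=
    h.2.1.comp t (by fun_prop : DifferentiableAt ℝ (fun s : ℝ => 1 - s) t)
  refine ⟨?_, ?_, fun w => ?_⟩
  · filter_upwards [hc.eventually h.1] with s hs
    exact hs.comp s (by fun_prop : DifferentiableAt ℝ (fun s : ℝ => 1 - s) s)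
  · rw [hd]
    exact hdiff.neg
  · have h1 : deriv (deriv fun s => x (1 - s)) t = deriv (deriv x) (1 - t) := by
      rw [hd]
      have := deriv_comp_const_sub (deriv x) 1 t
      rw [deriv.fun_neg, this, neg_neg]
    have h2 := h.2.2 w
    rw [h1, hd]
    simpa using h2

variable [FiniteDimensional ℝ E]

theorem isInvertible_of_pos {B : E →L[ℝ] E →L[ℝ] ℝ} (hB : ∀ v, v ≠ 0 → 0 < B v v) :
    B.IsInvertible := by
  have hinj : Function.Injective B := by
    rw [injective_iff_map_eq_zero]
    intro v hv
    by_contra hne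
    have := hB v hne
    rw [hv] at this
    simp at this
  have hrank : Module.finrank ℝ E = Module.finrank ℝ (E →L[ℝ] ℝ) := by
    rw [← (LinearMap.toContinuousLinearMap (𝕜 := ℝ) (E := E) (F' := ℝ)).finrank_eq]
    exact (Subspace.dual_finrank_eq (K := ℝ) (V := E)).symm
  let e := LinearEquiv.ofInjectiveOfFinrankEq (B : E →ₗ[ℝ] E →L[ℝ] ℝ) hinj hrank
  exact ⟨e.toContinuousLinearEquiv, rfl⟩

variable {G : E → E →L[ℝ] E →L[ℝ] ℝ} {U : Set E}

theorem contDiffOn_sprayOp (hU : IsOpen U) (hG : ContDiffOn ℝ ∞ G U)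
    (hpos : ∀ x ∈ U, ∀ v, v ≠ 0 → 0 < G x v v) : ContDiffOn ℝ ∞ (sprayOp G) (U ×ˢ univ) := by
  have : CompleteSpace E := FiniteDimensional.complete ℝ E
  have hfst : MapsTo Prod.fst (U ×ˢ (univ : Set E)) U := fun z hz => hz.1
  have h1 : ContDiffOn ℝ ∞ (fun z : E × E => (G z.1).inverse) (U ×ˢ univ) := by
    intro z hz
    obtain ⟨e, he⟩ := isInvertible_of_pos (hpos z.1 hz.1)
    have h2 : ContDiffAt ℝ ∞ ContinuousLinearMap.inverse (G z.1) := he ▸ contDiffAt_map_inverse e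
    exact h2.comp_contDiffWithinAt z ((hG.comp contDiffOn_fst hfst) z hz)
  have h3 : ContDiffOn ℝ ∞ (fun z : E × E => christoffelForm (fderiv ℝ G z.1)) (U ×ˢ univ) :=
    contDiff_christoffelForm.comp_contDiffOn
      ((hG.fderiv_of_isOpen hU (by simp)).comp contDiffOn_fst hfst)
  exact (h1.clm_comp (h3.clm_apply contDiffOn_snd)).neg

theorem contDiffOn_spray (hU : IsOpen U) (hG : ContDiffOn ℝ ∞ G U)
    (hpos : ∀ x ∈ U, ∀ v, v ≠ 0 → 0 < G x v v) : ContDiffOn ℝ ∞ (spray G) (U ×ˢ univ) :=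
  (contDiffOn_sprayOp hU hG hpos).clm_apply contDiffOn_snd

/-- The spray is quadratic in the velocity, so it vanishes to second order at velocity `0`. -/
theorem fderiv_spray_zero (hU : IsOpen U) (hG : ContDiffOn ℝ ∞ G U)
    (hpos : ∀ x ∈ U, ∀ v, v ≠ 0 → 0 < G x v v) {x : E} (hx : x ∈ U) :
    fderiv ℝ (spray G) (x, 0) = 0 := by
  have h1 : DifferentiableAt ℝ (sprayOp G) (x, 0) :=
    ((contDiffOn_sprayOp hU hG hpos).contDiffAt ((hU.prod isOpen_univ).mem_nhds
      ⟨hx, mem_univ _⟩)).differentiableAt (by simp)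
  have h2 := h1.hasFDerivAt.clm_apply (hasFDerivAt_snd (𝕜 := ℝ) (p := (x, (0 : E))))
  refine h2.fderiv.trans ?_
  simp [sprayOp_zero]

theorem GeodesicEqAt.deriv_deriv {x : ℝ → E} {t : ℝ} (h : GeodesicEqAt G x t)
    (hpos : ∀ v, v ≠ 0 → 0 < G (x t) v v) : deriv (deriv x) t = spray G (x t, deriv x t) := by
  have h1 : G (x t) (-deriv (deriv x) t) =
      christoffelForm (fderiv ℝ G (x t)) (deriv x t) (deriv x t) := by
    ext w
    have := h.2.2 w
    rw [map_neg, neg_apply, christoffelForm_apply]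
    linarith
  have h2 := (isInvertible_of_pos hpos).inverse_apply_eq.2 h1.symm
  change _ = -((G (x t)).inverse (christoffelForm (fderiv ℝ G (x t)) (deriv x t) (deriv x t)))
  rw [h2, neg_neg]

/-- The first order system of the geodesic equation. -/
theorem GeodesicEqAt.hasDerivAt {x : ℝ → E} {t : ℝ} (h : GeodesicEqAt G x t)
    (hpos : ∀ v, v ≠ 0 → 0 < G (x t) v v) :
    HasDerivAt (fun s => (x s, deriv x s)) (deriv x t, spray G (x t, deriv x t)) t := by
  have h1 := h.2.1.hasDerivAt
  rw [h.deriv_deriv hpos] at h1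
  exact h.1.self_of_nhds.hasDerivAt.prodMk h1

end Spray

section Geodesics

variable {E : Type*} [NormedAddCommGroup E] [NormedSpace ℝ E]
  {M : Type*} [TopologicalSpace M] [ChartedSpace E M] [IsManifold 𝓘(ℝ, E) ∞ M]

/-- Uniqueness of geodesics: a geodesic with the initial values of a solution of the geodesic
equation in a chart agrees with this solution, and so stays in the domain of the chart. -/
theorem IsGeodesic.eq_of_chart_solution [FiniteDimensional ℝ E] [T2Space M] {g : RMetric E M}
    {κ : OpenPartialHomeomorph M E} (hκ : κ ∈ IsManifold.maximalAtlas 𝓘(ℝ, E) ∞ M)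
    {γ : ℝ → M} {a b : ℝ} (hγ : IsGeodesic g γ a b) (ha : a < 0) (hb : 1 < b) {c y : ℝ → E}
    (hc : ∀ t ∈ Icc (0 : ℝ) 1, c t ∈ κ.target ∧ HasDerivAt c (y t) t ∧
      HasDerivAt y (spray (localMetric g κ) (c t, y t)) t)
    (h0 : γ 0 ∈ κ.source) (h0c : κ (γ 0) = c 0) (h0y : deriv (κ ∘ γ) 0 = y 0) :
    ∀ t ∈ Icc (0 : ℝ) 1, γ t ∈ κ.source ∧ κ (γ t) = c t ∧ deriv (κ ∘ γ) t = y t := by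
  have hI : ∀ t ∈ Icc (0 : ℝ) 1, t ∈ Ioo a b := fun t ht => ⟨ha.trans_le ht.1, ht.2.trans_lt hb⟩
  have hγc : ∀ t ∈ Ioo a b, ContinuousAt γ t := fun t ht =>
    hγ.1.continuousAt (Ioo_mem_nhds ht.1 ht.2)
  have hGs := contDiffOn_localMetric g hκ
  have hpos : ∀ x ∈ κ.target, ∀ v, v ≠ 0 → 0 < localMetric g κ x v v :=
    fun x hx v hv => localMetric_pos g hκ hx hv
  set s : Set ℝ := {t | γ t ∈ κ.source ∧ κ (γ t) = c t ∧ deriv (κ ∘ γ) t = y t} with hs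
  suffices Icc (0 : ℝ) 1 ⊆ s from this
  -- `s` is closed in `[0, 1]`, as `c` stays in the target of `κ`, and open to the right by local
  -- uniqueness of solutions of differential equations
  refine IsClosed.Icc_subset_of_forall_mem_nhdsWithin ?_ ⟨h0, h0c, h0y⟩ ?_
  · refine isClosed_of_closure_subset fun t ht => ?_
    have htI : t ∈ Icc (0 : ℝ) 1 := isClosed_Icc.closure_subset (closure_mono inter_subset_right ht)
    have hne : (𝓝[s ∩ Icc 0 1] t).NeBot := mem_closure_iff_nhdsWithin_neBot.1 ht
    obtain ⟨hct, hcd, hyd⟩ := hc t htI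
    have h1 : γ t = κ.symm (c t) := by
      have hl : Tendsto γ (𝓝[s ∩ Icc 0 1] t) (𝓝 (γ t)) := (hγc t (hI t htI)).mono_left inf_le_left
      have hr : Tendsto (κ.symm ∘ c) (𝓝[s ∩ Icc 0 1] t) (𝓝 (κ.symm (c t))) :=
        ((κ.continuousAt_symm hct).comp hcd.continuousAt).mono_left inf_le_left
      refine tendsto_nhds_unique (hl.congr' ?_) hr
      filter_upwards [self_mem_nhdsWithin] with τ hτ
      rw [Function.comp_apply, ← hτ.1.2.1, κ.left_inv hτ.1.1]
    have h2 : γ t ∈ κ.source := h1 ▸ κ.map_target hct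
    refine ⟨⟨h2, by rw [h1, κ.right_inv hct], ?_⟩, htI⟩
    have hl : Tendsto (deriv (κ ∘ γ)) (𝓝[s ∩ Icc 0 1] t) (𝓝 (deriv (κ ∘ γ) t)) :=
      ((hγ.2 κ hκ t (hI t htI) h2).2.1.continuousAt).mono_left inf_le_left
    have hr : Tendsto y (𝓝[s ∩ Icc 0 1] t) (𝓝 (y t)) := hyd.continuousAt.mono_left inf_le_left
    refine tendsto_nhds_unique (hl.congr' ?_) hr
    filter_upwards [self_mem_nhdsWithin] with τ hτ using hτ.1.2.2
  · rintro t ⟨⟨hts, htc, hty⟩, ht0, ht1⟩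
    have htI : t ∈ Icc (0 : ℝ) 1 := ⟨ht0, ht1.le⟩
    have hct := (hc t htI).1
    let f : E × E → E × E := fun z => (z.2, spray (localMetric g κ) z)
    have hf : ContDiffAt ℝ 1 f (c t, y t) := by
      refine contDiffAt_snd.prodMk ?_
      exact ((contDiffOn_spray κ.open_target hGs hpos).contDiffAt
        ((κ.open_target.prod isOpen_univ).mem_nhds ⟨hct, mem_univ _⟩)).of_le (mod_cast le_top)
    obtain ⟨L, O, hO, hL⟩ := hf.exists_lipschitzOnWith
    have hsrc : ∀ᶠ τ in 𝓝 t, τ ∈ Ioo a b ∧ γ τ ∈ κ.source :=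
      (isOpen_Ioo.eventually_mem (hI t htI)).and
        ((hγc t (hI t htI)).eventually (κ.open_source.mem_nhds hts))
    have hF : ∀ τ, τ ∈ Ioo a b ∧ γ τ ∈ κ.source →
        HasDerivAt (fun τ => ((κ ∘ γ) τ, deriv (κ ∘ γ) τ)) (f ((κ ∘ γ) τ, deriv (κ ∘ γ) τ)) τ :=
      fun τ hτ => (hγ.2 κ hκ τ hτ.1 hτ.2).hasDerivAt (hpos _ (κ.map_source hτ.2))
    have hH : ∀ τ ∈ Icc (0 : ℝ) 1, HasDerivAt (fun τ => (c τ, y τ)) (f (c τ, y τ)) τ :=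
      fun τ hτ => (hc τ hτ).2.1.prodMk (hc τ hτ).2.2
    have hFO : ∀ᶠ τ in 𝓝 t, ((κ ∘ γ) τ, deriv (κ ∘ γ) τ) ∈ O := by
      refine (hF t ⟨hI t htI, hts⟩).continuousAt.eventually ?_
      simpa [htc, hty] using hO
    have hHO : ∀ᶠ τ in 𝓝 t, (c τ, y τ) ∈ O := (hH t htI).continuousAt.eventually hO
    obtain ⟨d, hd, H⟩ := Metric.eventually_nhds_iff.1 (hsrc.and (hFO.and hHO))
    set u := min (t + d / 2) 1 with hu
    have htu : t < u := lt_min (by linarith) ht1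
    have hu1 : u ≤ 1 := min_le_right _ _
    have hball : ∀ τ ∈ Icc t u, dist τ t < d := fun τ hτ => by
      rw [Real.dist_eq, abs_of_nonneg (sub_nonneg.2 hτ.1)]
      have := hτ.2.trans (min_le_left _ _)
      linarith
    have hI' : ∀ τ ∈ Icc t u, τ ∈ Icc (0 : ℝ) 1 := fun τ hτ => ⟨ht0.trans hτ.1, hτ.2.trans hu1⟩
    have heq := ODE_solution_unique_of_mem_Icc_right (v := fun _ => f) (s := fun _ => O) (K := L)
      (f := fun τ => ((κ ∘ γ) τ, deriv (κ ∘ γ) τ)) (g := fun τ => (c τ, y τ)) (a := t) (b := u)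
      (fun _ _ => hL)
      (fun τ hτ => (hF τ (H (hball τ hτ)).1).continuousAt.continuousWithinAt)
      (fun τ hτ => (hF τ (H (hball τ (Ico_subset_Icc_self hτ))).1).hasDerivWithinAt)
      (fun τ hτ => (H (hball τ (Ico_subset_Icc_self hτ))).2.1)
      (fun τ hτ => (hH τ (hI' τ hτ)).continuousAt.continuousWithinAt)
      (fun τ hτ => (hH τ (hI' τ (Ico_subset_Icc_self hτ))).hasDerivWithinAt)
      (fun τ hτ => (H (hball τ (Ico_subset_Icc_self hτ))).2.2)
      (by simp [htc, hty])
    filter_upwards [Icc_mem_nhdsGT htu] with τ hτ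
    have := heq hτ
    exact ⟨(H (hball τ hτ)).1.2, (Prod.ext_iff.1 this).1, (Prod.ext_iff.1 this).2⟩

theorem IsGeodesic.reverse {g : RMetric E M} {γ : ℝ → M} {e : ℝ}
    (hγ : IsGeodesic g γ (-e) (1 + e)) : IsGeodesic g (fun t => γ (1 - t)) (-e) (1 + e) := by
  have hmaps : ∀ t ∈ Ioo (-e) (1 + e), 1 - t ∈ Ioo (-e) (1 + e) := fun t ht =>
    ⟨by linarith [ht.2], by linarith [ht.1]⟩
  refine ⟨hγ.1.comp (by fun_prop) hmaps, fun κ hκ t ht hts => ?_⟩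
  exact (hγ.2 κ hκ (1 - t) (hmaps t ht) hts).reverse

end Geodesics

/-! ### Inverses of exponential diffeomorphisms -/

section Reversal

variable {E : Type*} [NormedAddCommGroup E] [NormedSpace ℝ E]

/-- The derivative of `-Q ∘ F⁻¹` is small if the derivative of `F` is close to the identity and the
derivative of `Q` is small. -/
theorem norm_fderiv_neg_comp_inverse_le {F Q G Y : E → E} {z x : E} {F' Q' : E →L[ℝ] E} {δ : ℝ}
    (hδ : δ ≤ 1 / 4) (hF : HasFDerivAt F F' z) (hF' : ‖F' - .id ℝ E‖ ≤ 2 * δ)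
    (hQ : HasFDerivAt Q Q' z) (hQ' : ‖Q'‖ ≤ 2 * δ) (hG : DifferentiableAt ℝ G x) (hGx : G x = z)
    (hFG : ∀ᶠ x' in 𝓝 x, F (G x') = x') (hY : Y =ᶠ[𝓝 x] fun x' => -Q (G x')) :
    ‖fderiv ℝ Y x‖ ≤ 4 * δ := by
  subst hGx
  have h1 : F' ∘L fderiv ℝ G x = .id ℝ E := by
    have h2 : HasFDerivAt (fun x' => F (G x')) (F' ∘L fderiv ℝ G x) x := hF.comp x hG.hasFDerivAt
    exact h2.unique ((hasFDerivAt_id x).congr_of_eventuallyEq hFG)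
  have h2 : ‖fderiv ℝ G x‖ ≤ 2 := by
    refine ContinuousLinearMap.opNorm_le_bound _ zero_le_two fun h => ?_
    have h3 : F' (fderiv ℝ G x h) = h := DFunLike.congr_fun h1 h
    have h4 := ContinuousLinearMap.le_of_opNorm_le (F' - ContinuousLinearMap.id ℝ E) hF'
      (fderiv ℝ G x h)
    rw [sub_apply, ContinuousLinearMap.id_apply] at h4
    rw [h3] at h4
    have h5 := norm_sub_norm_le (fderiv ℝ G x h) h
    rw [norm_sub_rev] at h5
    nlinarith [norm_nonneg (fderiv ℝ G x h)]
  have h3 : HasFDerivAt (fun x' => -Q (G x')) (-(Q' ∘L fderiv ℝ G x)) x :=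
    (hQ.comp x hG.hasFDerivAt).neg
  have h4 := (norm_nonneg Q').trans hQ'
  rw [hY.fderiv_eq, h3.fderiv, norm_neg]
  calc ‖Q' ∘L fderiv ℝ G x‖ ≤ ‖Q'‖ * ‖fderiv ℝ G x‖ := ContinuousLinearMap.opNorm_comp_le _ _
    _ ≤ 2 * δ * 2 := by gcongr
    _ = 4 * δ := by ring

variable {M : Type*} [TopologicalSpace M] [ChartedSpace E M]

/-- The velocity of a curve, read in a chart. -/
theorem deriv_chart_comp [IsManifold 𝓘(ℝ, E) ∞ M] {κ : OpenPartialHomeomorph M E}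
    (hκ : κ ∈ IsManifold.maximalAtlas 𝓘(ℝ, E) ∞ M) {γ : ℝ → M} {t : ℝ} (hγ : ContinuousAt γ t)
    (hd : DifferentiableAt ℝ (κ ∘ γ) t) {p : M} (hp : p ∈ κ.source) {v : TangentSpace 𝓘(ℝ, E) p}
    (h : (⟨γ t, mfderiv 𝓘(ℝ, ℝ) 𝓘(ℝ, E) γ t (1 : ℝ)⟩ : TangentBundle 𝓘(ℝ, E) M) = ⟨p, v⟩) :
    deriv (κ ∘ γ) t = mfderiv 𝓘(ℝ, E) 𝓘(ℝ, E) κ p v := by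
  cases h
  have hκd := mdifferentiable_of_mem_maximalAtlas hκ
  have hγd : MDifferentiableAt 𝓘(ℝ, ℝ) 𝓘(ℝ, E) γ t := by
    have h1 : MDifferentiableAt 𝓘(ℝ, ℝ) 𝓘(ℝ, E) (κ.symm ∘ (κ ∘ γ)) t :=
      (hκd.mdifferentiableAt_symm (κ.map_source hp)).comp t hd.mdifferentiableAt
    refine h1.congr_of_eventuallyEq ?_
    filter_upwards [hγ.eventually (κ.open_source.mem_nhds hp)] with s hs
    exact (κ.left_inv hs).symm
  have h2 := mfderiv_comp t (hκd.mdifferentiableAt hp) hγd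
  rw [← fderiv_apply_one_eq_deriv, ← mfderiv_eq_fderiv, h2]
  rfl

variable [IsManifold 𝓘(ℝ, E) ∞ M]

/-- For each `p`, some geodesic `γ` has initial velocity `X p` and is at `ψ p` at time `1`, and its
reversal `t ↦ γ (1 - t)` has initial velocity `Y (ψ p)`. No smoothness of `Y` is asked for. -/
def IsReversal (g : RMetric E M) (X : VF E M) (ψ : M → M) (Y : ∀ p : M, TangentSpace 𝓘(ℝ, E) p) :
    Prop :=
  ∀ p, ∃ e > (0 : ℝ), ∃ γ : ℝ → M, IsGeodesic g γ (-e) (1 + e) ∧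
    (⟨γ 0, mfderiv 𝓘(ℝ, ℝ) 𝓘(ℝ, E) γ 0 (1 : ℝ)⟩ : TangentBundle 𝓘(ℝ, E) M) = ⟨p, X p⟩ ∧
    γ 1 = ψ p ∧
    (⟨γ (1 - 0), mfderiv 𝓘(ℝ, ℝ) 𝓘(ℝ, E) (fun t => γ (1 - t)) 0 (1 : ℝ)⟩ :
      TangentBundle 𝓘(ℝ, E) M) = ⟨ψ p, Y (ψ p)⟩

theorem IsExpComp.exists_isReversal {g : RMetric E M} {X : VF E M} {ψ : Equiv.Perm M}
    (h : IsExpComp g X ψ) : ∃ Y, IsReversal g X ψ Y := by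
  choose e he γ hγ h0 h1 using h
  refine ⟨fun q => (mfderiv 𝓘(ℝ, ℝ) 𝓘(ℝ, E) (fun t => γ (ψ.symm q) (1 - t)) 0 (1 : ℝ) : E),
    fun p => ⟨e p, he p, γ p, hγ p, h0 p, h1 p, ?_⟩⟩
  have h2 : γ p (1 - 0) = ψ p := by rw [sub_zero, h1]
  have h3 : ψ.symm (ψ p) = p := ψ.symm_apply_apply p
  have h4 : ∀ p', p = p' → (mfderiv 𝓘(ℝ, ℝ) 𝓘(ℝ, E) (fun t => γ p (1 - t)) 0 (1 : ℝ) : E) =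
      (mfderiv 𝓘(ℝ, ℝ) 𝓘(ℝ, E) (fun t => γ p' (1 - t)) 0 (1 : ℝ) : E) := by
    rintro _ rfl
    rfl
  exact TotalSpace.ext h2 (heq_of_eq (h4 _ h3.symm))

/-- The reversed geodesics show that `ψ⁻¹ = exp ∘ Y`. -/
theorem IsReversal.isExpComp {g : RMetric E M} {X : VF E M} {ψ : Equiv.Perm M} {Y : VF E M}
    (h : IsReversal g X ψ Y) : IsExpComp g Y ψ.symm := by
  intro q
  obtain ⟨e, he, γ, hγ, h0, -, hY⟩ := h (ψ.symm q)
  refine ⟨e, he, fun t => γ (1 - t), hγ.reverse, ?_, ?_⟩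
  · rw [ψ.apply_symm_apply] at hY
    exact hY
  · have := congrArg TotalSpace.proj h0
    simpa using this

end Reversal

section LocalReversal

variable {E : Type*} [NormedAddCommGroup E] [NormedSpace ℝ E]
  {M : Type*} [TopologicalSpace M] [ChartedSpace E M]

/-- The representation of a vector field `Y`, which need not be smooth, in the chart `κ`. -/
def vecLoc (Y : ∀ p : M, TangentSpace 𝓘(ℝ, E) p) (κ : OpenPartialHomeomorph M E) (x : E) : E :=
  mfderiv 𝓘(ℝ, E) 𝓘(ℝ, E) κ (κ.symm x) (Y (κ.symm x))

theorem vecLoc_apply (Y : ∀ p : M, TangentSpace 𝓘(ℝ, E) p) (κ : OpenPartialHomeomorph M E) {p : M}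
    (hp : p ∈ κ.source) : vecLoc Y κ (κ p) = mfderiv 𝓘(ℝ, E) 𝓘(ℝ, E) κ p (Y p) := by
  unfold vecLoc
  rw [κ.left_inv hp]

variable [IsManifold 𝓘(ℝ, E) ∞ M]

/-- The geodesics of a reversal, read in a chart in which the geodesic equation has a solution on
`[0, 1]` with the same initial values. -/
theorem IsReversal.chart_eq [FiniteDimensional ℝ E] [T2Space M] {g : RMetric E M} {X : VF E M}
    {ψ : M → M} {Y : ∀ p : M, TangentSpace 𝓘(ℝ, E) p} (h : IsReversal g X ψ Y)
    {κ : OpenPartialHomeomorph M E} (hκ : κ ∈ IsManifold.maximalAtlas 𝓘(ℝ, E) ∞ M) {p : M}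
    (hp : p ∈ κ.source) {c y : ℝ → E}
    (hc : ∀ t ∈ Icc (0 : ℝ) 1, c t ∈ κ.target ∧ HasDerivAt c (y t) t ∧
      HasDerivAt y (spray (localMetric g κ) (c t, y t)) t)
    (hc0 : c 0 = κ p) (hy0 : y 0 = vfLoc X κ (κ p)) :
    ψ p ∈ κ.source ∧ κ (ψ p) = c 1 ∧ vecLoc Y κ (κ (ψ p)) = -y 1 := by
  obtain ⟨e, he, γ, hγ, h0, h1, h2⟩ := h p
  have hγ0 : γ 0 = p := congrArg TotalSpace.proj h0
  have hI : ∀ t ∈ Icc (0 : ℝ) 1, t ∈ Ioo (-e) (1 + e) := fun t ht =>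
    ⟨by linarith [ht.1], by linarith [ht.2]⟩
  have hγc : ∀ t ∈ Icc (0 : ℝ) 1, ContinuousAt γ t := fun t ht =>
    hγ.1.continuousAt (Ioo_mem_nhds (hI t ht).1 (hI t ht).2)
  have hl : (0 : ℝ) ∈ Icc (0 : ℝ) 1 := left_mem_Icc.2 zero_le_one
  have hr : (1 : ℝ) ∈ Icc (0 : ℝ) 1 := right_mem_Icc.2 zero_le_one
  have hd0 := deriv_chart_comp hκ (hγc 0 hl)
    (hγ.2 κ hκ 0 (hI 0 hl) (hγ0 ▸ hp)).1.self_of_nhds hp h0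
  rw [← vfLoc_apply X κ hp, ← hy0] at hd0
  obtain ⟨hs, hc1, hy1⟩ := hγ.eq_of_chart_solution hκ (by linarith) (by linarith) hc
    (hγ0 ▸ hp) (by rw [hγ0, hc0]) hd0 1 hr
  rw [h1] at hs hc1
  refine ⟨hs, hc1, ?_⟩
  have hd1 : DifferentiableAt ℝ (κ ∘ γ) 1 :=
    (hγ.2 κ hκ 1 (hI 1 hr) (h1.symm ▸ hs)).1.self_of_nhds
  have hγ1 : ContinuousAt (fun t => γ (1 - t)) 0 := by
    refine ContinuousAt.comp (g := γ) ?_ (by fun_prop)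
    rw [sub_zero]
    exact hγc 1 hr
  have hd2 : DifferentiableAt ℝ (κ ∘ fun t => γ (1 - t)) 0 := by
    refine DifferentiableAt.comp (g := κ ∘ γ) (0 : ℝ) ?_ (by fun_prop)
    rw [sub_zero]
    exact hd1
  have hd3 := deriv_chart_comp hκ hγ1 hd2 hs h2
  rw [vecLoc_apply Y κ hs, ← hd3, ← hy1]
  have h3 := deriv_comp_const_sub (κ ∘ γ) 1 0
  rw [sub_zero] at h3
  exact h3

/-- Let `ψ = exp ∘ X`, where `X` is small in `C¹` near a point in a chart. Then the vector field `Y`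
of initial velocities of the reversed geodesics is smooth and small in `C¹` near the image of this
point under `ψ`. -/
theorem exists_small_reversal_near [FiniteDimensional ℝ E] [T2Space M] (g : RMetric E M)
    {κ : OpenPartialHomeomorph M E} (hκ : κ ∈ IsManifold.maximalAtlas 𝓘(ℝ, E) ∞ M) {z₀ : E}
    (hz₀ : z₀ ∈ κ.target) {N : Set E} (hN : N ∈ 𝓝 z₀) {ε : ℝ} (hε : 0 < ε) :
    ∃ η > 0, ∀ (X : VF E M) (ψ : diffGroup E M) (Y : ∀ p : M, TangentSpace 𝓘(ℝ, E) p),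
      IsReversal g X ψ.1 Y → ∀ O : Set E, IsOpen O → O ⊆ Metric.ball z₀ η →
      (∀ x ∈ O, ‖vfLoc X κ x‖ < η ∧ ‖fderiv ℝ (vfLoc X κ) x‖ < η) →
      ∀ p ∈ κ.source, κ p ∈ O → ψ.1 p ∈ κ.source ∧ κ (ψ.1 p) ∈ N ∧
        ContDiffAt ℝ ∞ (vecLoc Y κ) (κ (ψ.1 p)) ∧ ‖vecLoc Y κ (κ (ψ.1 p))‖ ≤ ε ∧
        ‖fderiv ℝ (vecLoc Y κ) (κ (ψ.1 p))‖ ≤ ε ∧ (X p = 0 → Y (ψ.1 p) = 0) := by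
  have hpos : ∀ x ∈ κ.target, ∀ v, v ≠ 0 → 0 < localMetric g κ x v v :=
    fun x hx v hv => localMetric_pos g hκ hx hv
  have hGs := contDiffOn_localMetric g hκ
  -- `1 / 4` makes the derivative of `F` below invertible, with inverse of norm at most `2`
  set ε' := min (1 / 4) (ε / 4) with hε'
  have hε'0 : 0 < ε' := lt_min (by norm_num) (by linarith)
  have hε'1 : ε' ≤ 1 / 4 := min_le_left _ _
  have hε'2 : ε' ≤ ε / 4 := min_le_right _ _
  obtain ⟨η, hη, c, y, H⟩ := exists_shortTimeFlow κ.open_target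
    (contDiffOn_spray κ.open_target hGs hpos) (fun x _ => spray_zero _ x) hz₀
    (fderiv_spray_zero κ.open_target hGs hpos hz₀) hN hε'0
  refine ⟨min η ε', lt_min hη hε'0, fun X ψ Y hY O hO hOη hX p hp hpO => ?_⟩
  have hmem : ∀ z ∈ O, (z, vfLoc X κ z) ∈ Metric.ball z₀ η ×ˢ Metric.ball (0 : E) η := by
    refine fun z hz => ⟨Metric.ball_subset_ball (min_le_left _ _) (hOη hz), ?_⟩
    rw [mem_ball_zero_iff]
    exact (hX z hz).1.trans_le (min_le_left _ _)
  have hl : (0 : ℝ) ∈ Icc (0 : ℝ) 1 := left_mem_Icc.2 zero_le_one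
  have hr : (1 : ℝ) ∈ Icc (0 : ℝ) 1 := right_mem_Icc.2 zero_le_one
  -- `ψ` in the chart is `F`, and the velocities at the endpoints of the geodesics are given by `Q`
  set F : E → E := fun z => c (z, vfLoc X κ z) 1 with hF
  set Q : E → E := fun z => y (z, vfLoc X κ z) 1 with hQ
  have hkey : ∀ q ∈ κ.source, κ q ∈ O →
      ψ.1 q ∈ κ.source ∧ κ (ψ.1 q) = F (κ q) ∧ vecLoc Y κ (κ (ψ.1 q)) = -Q (κ q) := by
    intro q hq hqO
    obtain ⟨h1, h2, -⟩ := H _ (hmem _ hqO)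
    exact hY.chart_eq hκ hq (fun t ht => ⟨(h2 t ht).1.1, (h2 t ht).2⟩) h1.1 h1.2
  obtain ⟨hs, hFp, hQp⟩ := hkey p hp hpO
  obtain ⟨h1, h2, ⟨hcs, hys⟩, hcb, hyb, hyε, hy0⟩ := H _ (hmem _ hpO)
  have hGd : ContDiffAt ℝ ∞ (fun x => κ (ψ.1.symm (κ.symm x))) (κ (ψ.1 p)) := by
    have h1 : ContMDiffAt 𝓘(ℝ, E) 𝓘(ℝ, E) ∞ κ.symm (κ (ψ.1 p)) :=
      contMDiffAt_symm_of_mem_maximalAtlas hκ (κ.map_source hs)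
    have h2 : ContMDiffAt 𝓘(ℝ, E) 𝓘(ℝ, E) ∞ (ψ.1.symm ∘ κ.symm) (κ (ψ.1 p)) :=
      ψ.2.2.contMDiffAt.comp _ h1
    have h3 : ContMDiffAt 𝓘(ℝ, E) 𝓘(ℝ, E) ∞ (κ ∘ (ψ.1.symm ∘ κ.symm)) (κ (ψ.1 p)) := by
      refine ContMDiffAt.comp _ ?_ h2
      rw [Function.comp_apply, κ.left_inv hs, Equiv.symm_apply_apply]
      exact contMDiffAt_of_mem_maximalAtlas hκ hp
    exact h3.contDiffAt
  have hGp : κ (ψ.1.symm (κ.symm (κ (ψ.1 p)))) = κ p := by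
    rw [κ.left_inv hs, Equiv.symm_apply_apply]
  have hnear : ∀ᶠ x in 𝓝 (κ (ψ.1 p)), x ∈ κ.target ∧ ψ.1.symm (κ.symm x) ∈ κ.source ∧
      κ (ψ.1.symm (κ.symm x)) ∈ O := by
    have hcont : ContinuousAt (fun x => ψ.1.symm (κ.symm x)) (κ (ψ.1 p)) :=
      ψ.2.2.continuous.continuousAt.comp (κ.continuousAt_symm (κ.map_source hs))
    refine (κ.open_target.eventually_mem (κ.map_source hs)).and
      ((hcont.eventually (κ.open_source.mem_nhds ?_)).and
      (hGd.continuousAt.eventually (hO.mem_nhds ?_)))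
    · change ψ.1.symm (κ.symm (κ (ψ.1 p))) ∈ κ.source
      rwa [κ.left_inv hs, Equiv.symm_apply_apply]
    · change κ (ψ.1.symm (κ.symm (κ (ψ.1 p)))) ∈ O
      rwa [hGp]
  have hFG : ∀ᶠ x in 𝓝 (κ (ψ.1 p)), F (κ (ψ.1.symm (κ.symm x))) = x := by
    filter_upwards [hnear] with x hx
    have := (hkey _ hx.2.1 hx.2.2).2.1
    rw [← this, Equiv.apply_symm_apply, κ.right_inv hx.1]
  have hYQ : vecLoc Y κ =ᶠ[𝓝 (κ (ψ.1 p))] fun x => -Q (κ (ψ.1.symm (κ.symm x))) := by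
    filter_upwards [hnear] with x hx
    have := (hkey _ hx.2.1 hx.2.2).2.2
    rw [← this, Equiv.apply_symm_apply, κ.right_inv hx.1]
  have hXd : ContDiffAt ℝ ∞ (vfLoc X κ) (κ p) :=
    (contDiffOn_vfLoc X hκ).contDiffAt (κ.open_target.mem_nhds (κ.map_source hp))
  have hpair : ContDiffAt ℝ ∞ (fun z => (z, vfLoc X κ z)) (κ p) := contDiffAt_id.prodMk hXd
  set X' := fderiv ℝ (vfLoc X κ) (κ p) with hX'
  have hX'ε : ‖X'‖ ≤ ε' := ((hX _ hpO).2.trans_le (min_le_right _ _)).le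
  have hXfd : HasFDerivAt (fun z => (z, vfLoc X κ z)) ((ContinuousLinearMap.id ℝ E).prod X')
      (κ p) := (hasFDerivAt_id _).prodMk (hXd.differentiableAt (by simp)).hasFDerivAt
  have hpn : ‖(ContinuousLinearMap.id ℝ E).prod X'‖ ≤ 1 := by
    refine ContinuousLinearMap.opNorm_le_bound _ zero_le_one fun v => ?_
    rw [one_mul]
    refine norm_prod_le_iff.2 ⟨le_rfl, (X'.le_of_opNorm_le hX'ε v).trans ?_⟩
    nlinarith [norm_nonneg v]
  have hest : ∀ A B : E × E →L[ℝ] E, ‖A - B‖ ≤ ε' →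
      ‖A ∘L (ContinuousLinearMap.id ℝ E).prod X' - B ∘L (ContinuousLinearMap.id ℝ E).prod X'‖
        ≤ ε' := by
    intro A B hAB
    rw [← ContinuousLinearMap.sub_comp]
    refine (ContinuousLinearMap.opNorm_comp_le _ _).trans ?_
    nlinarith [norm_nonneg (A - B), norm_nonneg ((ContinuousLinearMap.id ℝ E).prod X')]
  have hF1 : HasFDerivAt F (fderiv ℝ (fun q => c q 1) (κ p, vfLoc X κ (κ p)) ∘L
      (ContinuousLinearMap.id ℝ E).prod X') (κ p) :=
    HasFDerivAt.comp (g := fun q => c q 1) (κ p) (hcs.differentiableAt (by simp)).hasFDerivAt hXfd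
  have hQ1 : HasFDerivAt Q (fderiv ℝ (fun q => y q 1) (κ p, vfLoc X κ (κ p)) ∘L
      (ContinuousLinearMap.id ℝ E).prod X') (κ p) :=
    HasFDerivAt.comp (g := fun q => y q 1) (κ p) (hys.differentiableAt (by simp)).hasFDerivAt hXfd
  have hFb := hest _ _ hcb
  have hQb := hest _ _ hyb
  rw [ContinuousLinearMap.add_comp, ContinuousLinearMap.fst_comp_prod,
    ContinuousLinearMap.snd_comp_prod] at hFb
  rw [ContinuousLinearMap.snd_comp_prod] at hQb
  refine ⟨hs, ?_, ?_, ?_, ?_, fun hXp => ?_⟩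
  · rw [hFp]
    exact (h2 1 hr).1.2
  · refine ContDiffAt.congr_of_eventuallyEq ?_ hYQ
    refine ContDiffAt.neg (ContDiffAt.comp (g := Q) _ ?_ hGd)
    rw [hGp]
    exact ContDiffAt.comp (κ p) hys hpair
  · rw [hQp, norm_neg]
    exact hyε.trans (by linarith)
  · refine (norm_fderiv_neg_comp_inverse_le hε'1 hF1 ?_ hQ1 ?_ (hGd.differentiableAt (by simp)) hGp
      hFG hYQ).trans (by linarith)
    · refine (norm_le_norm_add_norm_sub' _ X').trans ?_
      rw [sub_sub]
      linarith
    · exact (norm_le_norm_add_norm_sub' _ X').trans (by linarith)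
  · have hX0 : vfLoc X κ (κ p) = 0 := by
      rw [vfLoc_apply X κ hp]
      exact (congrArg _ hXp).trans (map_zero _)
    have h3 : -Q (κ p) = 0 := neg_eq_zero.2 (hy0 hX0)
    have h4 : mfderiv 𝓘(ℝ, E) 𝓘(ℝ, E) κ (ψ.1 p) (Y (ψ.1 p)) = (0 : E) :=
      (vecLoc_apply Y κ hs).symm.trans (hQp.trans h3)
    rw [← mfderiv_symm_mfderiv hκ hs (Y (ψ.1 p))]
    exact (congrArg _ h4).trans (map_zero _)

/-- The preceding statement, uniformly on a ball in a chart. -/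
theorem exists_small_reversal [FiniteDimensional ℝ E] [T2Space M] (g : RMetric E M)
    {κ : OpenPartialHomeomorph M E} (hκ : κ ∈ IsManifold.maximalAtlas 𝓘(ℝ, E) ∞ M) {ρ ρ' : ℝ}
    (hρ : ρ < ρ') (hρ' : Metric.closedBall 0 ρ' ⊆ κ.target) {ε : ℝ} (hε : 0 < ε) :
    ∃ η > 0, ∀ (X : VF E M) (ψ : diffGroup E M) (Y : ∀ p : M, TangentSpace 𝓘(ℝ, E) p),
      IsReversal g X ψ.1 Y →
      (∀ x ∈ Metric.ball 0 ρ, ‖vfLoc X κ x‖ < η ∧ ‖fderiv ℝ (vfLoc X κ) x‖ < η) →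
      ∀ p ∈ κ.source, κ p ∈ Metric.ball 0 ρ → ψ.1 p ∈ κ.source ∧
        κ (ψ.1 p) ∈ Metric.ball 0 ρ' ∧
        ContDiffAt ℝ ∞ (vecLoc Y κ) (κ (ψ.1 p)) ∧ ‖vecLoc Y κ (κ (ψ.1 p))‖ ≤ ε ∧
        ‖fderiv ℝ (vecLoc Y κ) (κ (ψ.1 p))‖ ≤ ε ∧ (X p = 0 → Y (ψ.1 p) = 0) := by
  have hball : Metric.closedBall (0 : E) ρ ⊆ Metric.ball 0 ρ' :=
    Metric.closedBall_subset_ball hρ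
  choose! η hη H using fun z (hz : z ∈ Metric.closedBall (0 : E) ρ) =>
    exists_small_reversal_near g hκ (hρ' (Metric.ball_subset_closedBall (hball hz)))
      (Metric.isOpen_ball.mem_nhds (hball hz)) hε
  obtain ⟨T, hT, hcov⟩ := (isCompact_closedBall (0 : E) ρ).elim_nhds_subcover
    (fun z => Metric.ball z (η z)) fun z hz => Metric.ball_mem_nhds z (hη z hz)
  obtain ⟨η₀, hη₀, hle⟩ : ∃ η₀ > 0, ∀ z ∈ T, η₀ ≤ η z := by
    rcases T.eq_empty_or_nonempty with rfl | hne
    · exact ⟨1, one_pos, by simp⟩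
    · obtain ⟨z, hz, hmin⟩ := T.exists_min_image η hne
      exact ⟨η z, hη z (hT z hz), hmin⟩
  refine ⟨η₀, hη₀, fun X ψ Y hY hX p hp hpρ => ?_⟩
  obtain ⟨z, hz, hpz⟩ := mem_iUnion₂.1 (hcov (Metric.ball_subset_closedBall hpρ))
  exact H z (hT z hz) X ψ Y hY (Metric.ball z (η z) ∩ Metric.ball 0 ρ)
    (Metric.isOpen_ball.inter Metric.isOpen_ball) inter_subset_left
    (fun x hx => ⟨(hX x hx.2).1.trans_le (hle z hz), (hX x hx.2).2.trans_le (hle z hz)⟩) p hp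
    ⟨hpz, hpρ⟩

end LocalReversal

/-! ### A neighbourhood of the identity -/

section Neighbourhood

variable {E : Type*} [NormedAddCommGroup E] [NormedSpace ℝ E]
  {M : Type*} [TopologicalSpace M] [ChartedSpace E M] [IsManifold 𝓘(ℝ, E) ∞ M]
  {ι : Type*} {κ : ι → OpenPartialHomeomorph M E} {r : ι → ℝ}

theorem IsLocalSeminorm.mem_nhds_zero [FiniteDimensional ℝ E]
    (hκ : ∀ i, κ i ∈ IsManifold.maximalAtlas 𝓘(ℝ, E) ∞ M)
    (hr : ∀ i, Metric.closedBall 0 (r i) ⊆ (κ i).target)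
    {N : VF E M → ℝ≥0∞} (hN : IsLocalSeminorm κ r N) {e : ℝ≥0∞} (he : 0 < e) :
    {X : compactVF E M | N X.1 < e} ∈ @nhds _ (compactVFTopology E M) 0 := by
  let := compactVFTopology E M
  have h1 := hN.isOpen hκ hr 0 (fun X => by rw [sub_zero]; exact hN.lt_top hκ hr X) e
  simp only [sub_zero] at h1
  refine h1.mem_nhds ?_
  have h2 := hN.smul_eq 0 0
  rw [zero_smul, enorm_zero, zero_mul] at h2
  rw [mem_ofPred_eq, Submodule.coe_zero, h2]
  exact he

theorem ballNorm_eq_zero [T2Space M] (hr : ∀ i, Metric.closedBall 0 (r i) ⊆ (κ i).target) {i : ι}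
    {K : Set M} (hK : IsCompact K) (hiK : ¬((κ i).source ∩ K).Nonempty) {X : VF E M}
    (hX : ∀ p ∉ K, X p = 0) (ℓ : ℕ) : ballNorm κ r i ℓ X = 0 := by
  refine Finset.sum_eq_zero fun l _ => le_antisymm (iSup₂_le fun x hx => ?_) zero_le
  rw [← ofReal_norm, iteratedFDeriv_vfLoc_eq_zero hK hX l (hr i hx)
    fun h => hiK ⟨_, (κ i).map_target (hr i hx), h⟩]
  simp

/-- Weighted suprema of the seminorms `ballNorm`, with arbitrary finite weights: the weights may be
unbounded as only finitely many charts meet a given compact set. -/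
theorem isLocalSeminorm_iSup_ballNorm [T2Space M] (hκ : IsLocallyFiniteAtlas κ)
    (hr : ∀ i, Metric.closedBall 0 (r i) ⊆ (κ i).target) (a : ι → ℝ≥0) (ℓ : ℕ) :
    IsLocalSeminorm κ r fun X => ⨆ i, a i * ballNorm κ r i ℓ X where
  add_le X Y := by
    refine iSup_le fun i => ?_
    refine le_trans ?_ (add_le_add (le_iSup_of_le i le_rfl) (le_iSup_of_le i le_rfl))
    rw [← mul_add]
    refine mul_le_mul' le_rfl ?_
    unfold ballNorm
    rw [← Finset.sum_add_distrib]
    exact Finset.sum_le_sum fun l _ =>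
      wnorm_vfLoc_add_le X Y (hκ.mem_maximalAtlas i) (hr i) _ l
  smul_eq c X := by
    rw [ENNReal.mul_iSup]
    refine iSup_congr fun i => ?_
    rw [mul_left_comm]
    congr 1
    unfold ballNorm
    rw [Finset.mul_sum]
    exact Finset.sum_congr rfl fun l _ => wnorm_vfLoc_smul c X (hκ.mem_maximalAtlas i) (hr i) _ l
  bound K hK := by
    have hfin := hκ.locallyFinite.finite_nonempty_inter_compact hK
    refine ⟨hfin.toFinset, ℓ, ∑ i ∈ hfin.toFinset, a i, fun X hX => iSup_le fun i => ?_⟩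
    by_cases hi : ((κ i).source ∩ K).Nonempty
    · have hiF : i ∈ hfin.toFinset := hfin.mem_toFinset.2 hi
      refine mul_le_mul' ?_ (Finset.single_le_sum (f := fun i => ballNorm κ r i ℓ X)
        (fun _ _ => zero_le) hiF)
      exact ENNReal.coe_le_coe.2 (Finset.single_le_sum (fun _ _ => zero_le) hiF)
    · rw [ballNorm_eq_zero hr hK hi hX, mul_zero]
      exact zero_le

/-- If `ψ = exp ∘ X` is a compactly supported diffeomorphism and `X` is small in `C¹` in each chart,
then `ψ⁻¹ = exp ∘ Y` for a compactly supported vector field `Y`, which is small in `C¹` in some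
chart around each point. -/
theorem exists_compactVF_reversal [FiniteDimensional ℝ E] [T2Space M] (g : RMetric E M) {R : ℝ}
    (hκ : IsLocallyFiniteAtlas κ)
    (hκr : ∀ p : M, ∃ i, p ∈ (κ i).source ∧ κ i p ∈ Metric.ball (0 : E) (r i)) (hR : 0 < R)
    (hr : ∀ i, Metric.closedBall 0 (r i + R) ⊆ (κ i).target) {ε : ι → ℝ} (hε : ∀ i, 0 < ε i) :
    ∃ η : ι → ℝ, (∀ i, 0 < η i) ∧ ∀ (X : compactVF E M) (ψ : compactDiff E M),
      IsExpComp g X.1 ψ.1.1 → (∀ i, ∀ x ∈ Metric.ball 0 (r i),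
        ‖vfLoc X.1 (κ i) x‖ < η i ∧ ‖fderiv ℝ (vfLoc X.1 (κ i)) x‖ < η i) →
      ∃ Y : compactVF E M, IsExpComp g Y.1 (ψ⁻¹).1.1 ∧ ∀ q, ∃ i, q ∈ (κ i).source ∧
        κ i q ∈ Metric.ball 0 (r i + R) ∧ ‖vfLoc Y.1 (κ i) (κ i q)‖ ≤ ε i ∧
        ‖fderiv ℝ (vfLoc Y.1 (κ i)) (κ i q)‖ ≤ ε i := by
  have : CompleteSpace E := FiniteDimensional.complete ℝ E
  choose η hη H using fun i => exists_small_reversal g (hκ.mem_maximalAtlas i)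
    (lt_add_of_pos_right (r i) hR) (hr i) (hε i)
  refine ⟨η, hη, fun X ψ hψ hX => ?_⟩
  obtain ⟨Y, hY⟩ := hψ.exists_isReversal
  -- each point is of the form `ψ p`, with `p` in one of the balls of radius `r i`
  have hq : ∀ q, ∃ i, q ∈ (κ i).source ∧ κ i q ∈ Metric.ball 0 (r i + R) ∧
      ContDiffAt ℝ ∞ (vecLoc Y (κ i)) (κ i q) ∧ ‖vecLoc Y (κ i) (κ i q)‖ ≤ ε i ∧
      ‖fderiv ℝ (vecLoc Y (κ i)) (κ i q)‖ ≤ ε i ∧ (X.1 (ψ.1.1.symm q) = 0 → Y q = 0) := by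
    intro q
    obtain ⟨i, hi, hir⟩ := hκr (ψ.1.1.symm q)
    have := H i X.1 ψ.1 Y hY (hX i) _ hi hir
    rw [ψ.1.1.apply_symm_apply] at this
    exact ⟨i, this⟩
  have hYs : ContMDiff 𝓘(ℝ, E) (𝓘(ℝ, E).prod 𝓘(ℝ, E)) ∞ fun p => TotalSpace.mk' E p (Y p) := by
    refine contMDiff_of_forall_exists_chart Y fun q => ?_
    obtain ⟨i, hi, -, hd, -⟩ := hq q
    exact ⟨κ i, hκ.mem_maximalAtlas i, hi, hd⟩
  obtain ⟨K, hK, hXK⟩ := X.2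
  obtain ⟨L, hL, hψL⟩ := ψ.2
  let Z : VF E M := ⟨Y, hYs⟩
  have hZ : ∀ q ∉ K ∪ L, Z q = 0 := by
    intro q hqKL
    rw [mem_union, not_or] at hqKL
    obtain ⟨i, -, -, -, -, -, h0⟩ := hq q
    refine h0 ?_
    have h1 : ψ.1.1.symm q = q := (Equiv.symm_apply_eq _).2 (hψL q hqKL.2).symm
    rw [h1]
    exact hXK q hqKL.1
  refine ⟨⟨Z, K ∪ L, hK.union hL, hZ⟩, IsReversal.isExpComp (Y := Z) hY, fun q => ?_⟩
  obtain ⟨i, hi, hiR, -, h0, h1, -⟩ := hq q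
  exact ⟨i, hi, hiR, h0, h1⟩

end Neighbourhood

section SmallWeightedDiff

variable {E : Type*} [NormedAddCommGroup E] [NormedSpace ℝ E]
  {M : Type*} [TopologicalSpace M] [ChartedSpace E M] [IsManifold 𝓘(ℝ, E) ∞ M]
  {ι : Type*} {κ : ι → OpenPartialHomeomorph M E} {r : ι → ℝ}

theorem vfNorm_mono {S T : ι → Set E} (h : ∀ i, S i ⊆ T i) (f : M → WithTop ℝ) (ℓ : ℕ)
    (X : VF E M) : vfNorm κ S f ℓ X ≤ vfNorm κ T f ℓ X :=
  iSup_mono fun i => wnorm_mono (h i) _ ℓ _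

/-- Thresholds `ε i` such that a vector field which, around each point, is bounded by `ε i` together
with its first derivative in some chart `κ i`, has small weighted norms in all charts. -/
theorem exists_thresholds_vfNorm [FiniteDimensional ℝ E] {R : ℝ} (hκ : IsLocallyFiniteAtlas κ)
    (hr : ∀ i, Metric.closedBall 0 (r i + R) ⊆ (κ i).target) (hbt : HasBoundedTransitions κ)
    {f : M → WithTop ℝ} (hf : ∀ K, IsCompact K → ∃ C : ℝ≥0, ∀ p ∈ K, wabs (f p) ≤ C)
    {e : ℝ≥0} (he : 0 < e) :
    ∃ ε : ι → ℝ, (∀ i, 0 < ε i) ∧ ∀ Y : VF E M,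
      (∀ q, ∃ i, q ∈ (κ i).source ∧ κ i q ∈ Metric.ball 0 (r i + R) ∧
        ‖vfLoc Y (κ i) (κ i q)‖ ≤ ε i ∧ ‖fderiv ℝ (vfLoc Y (κ i)) (κ i q)‖ ≤ ε i) →
      vfNorm κ (fun i => Metric.ball 0 (r i + R)) f 0 Y ≤ e ∧
        vfNorm κ (fun i => Metric.ball 0 (r i + R)) (fun _ => ((1 : ℝ) : WithTop ℝ)) 1 Y ≤ e := by
  have : ProperSpace E := FiniteDimensional.proper ℝ E
  have hA : ∀ i, IsCompact ((κ i).symm '' Metric.closedBall 0 (r i + R)) := fun i =>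
    (isCompact_closedBall _ _).image_of_continuousOn ((κ i).symm.continuousOn.mono (hr i))
  have hfin := fun i => hκ.locallyFinite.finite_nonempty_inter_compact (hA i)
  choose B hB using fun j => hf _ (hA j)
  choose C₀ hC₀ using fun i j => hbt.exists_norm_iteratedFDeriv_le hκ.mem_maximalAtlas i j 0
  choose C₁ hC₁ using fun i j => hbt.exists_norm_iteratedFDeriv_le hκ.mem_maximalAtlas i j 1
  -- only the finitely many charts `κ j` that meet the compact set `κ i⁻¹ (closedBall 0 (r i + R))`
  -- have to be taken into account
  set D : ι → ℝ≥0 := fun i => ∑ j ∈ (hfin i).toFinset, (B j * C₀ i j + C₁ i j * 2) with hD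
  set ε : ι → ℝ≥0 := fun i => e / (D i + 1) with hε
  have hDε : ∀ i, D i * ε i ≤ e := fun i => by
    have h1 : 0 < D i + 1 := add_pos_of_nonneg_of_pos zero_le one_pos
    calc D i * ε i ≤ (D i + 1) * ε i := mul_le_mul' le_self_add le_rfl
      _ = e := mul_div_cancel₀ _ h1.ne'
  refine ⟨fun i => ε i, fun i => NNReal.coe_pos.2
    (div_pos he (add_pos_of_nonneg_of_pos zero_le one_pos)), fun Y hY => ?_⟩
  -- the estimate in the chart `κ j` at the point `κ j⁻¹ x`
  have key : ∀ j, ∀ x ∈ Metric.ball (0 : E) (r j + R),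
      wabs (f ((κ j).symm x)) * ‖iteratedFDeriv ℝ 0 (vfLoc Y (κ j)) x‖ₑ ≤ e ∧
        ‖iteratedFDeriv ℝ 1 (vfLoc Y (κ j)) x‖ₑ ≤ e := by
    intro j x hx
    have hxj := Metric.ball_subset_closedBall hx
    have hqj : (κ j).symm x ∈ (κ j).source := (κ j).map_target (hr j hxj)
    obtain ⟨i, hi, hir, h0, h1⟩ := hY ((κ j).symm x)
    have hjF : j ∈ (hfin i).toFinset := by
      refine (hfin i).mem_toFinset.2 ⟨_, hqj, κ i ((κ j).symm x), Metric.ball_subset_closedBall hir,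
        (κ i).left_inv hi⟩
    have hle := (Finset.single_le_sum (f := fun j => B j * C₀ i j + C₁ i j * 2)
      (fun _ _ => zero_le) hjF)
    have h0' : ‖iteratedFDeriv ℝ 0 (vfLoc Y (κ i)) (κ i ((κ j).symm x))‖ₑ ≤ ε i := by
      rw [← ofReal_norm, norm_iteratedFDeriv_zero, ← ENNReal.ofReal_coe_nnreal]
      exact ENNReal.ofReal_le_ofReal h0
    have h1' : ‖iteratedFDeriv ℝ 1 (vfLoc Y (κ i)) (κ i ((κ j).symm x))‖ₑ ≤ ε i := by
      rw [← ofReal_norm, norm_iteratedFDeriv_one, ← ENNReal.ofReal_coe_nnreal]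
      exact ENNReal.ofReal_le_ofReal h1
    have hc0 := hC₀ i j Y _ hi hqj
    have hc1 := hC₁ i j Y _ hi hqj
    rw [(κ j).right_inv (hr j hxj)] at hc0 hc1
    rw [zero_add, Finset.sum_range_one] at hc0
    rw [Finset.sum_range_succ, Finset.sum_range_one] at hc1
    have hfB : wabs (f ((κ j).symm x)) ≤ B j := hB j _ ⟨x, hxj, rfl⟩
    constructor
    · calc wabs (f ((κ j).symm x)) * ‖iteratedFDeriv ℝ 0 (vfLoc Y (κ j)) x‖ₑ
          ≤ B j * (C₀ i j * ε i) := mul_le_mul' hfB (hc0.trans (mul_le_mul' le_rfl h0'))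
        _ = ((B j * C₀ i j * ε i : ℝ≥0) : ℝ≥0∞) := by push_cast; ring
        _ ≤ e := ENNReal.coe_le_coe.2
          ((mul_le_mul' (le_self_add.trans hle) le_rfl).trans (hDε i))
    · calc ‖iteratedFDeriv ℝ 1 (vfLoc Y (κ j)) x‖ₑ
          ≤ C₁ i j * (ε i + ε i) := hc1.trans (mul_le_mul' le_rfl (add_le_add h0' h1'))
        _ = ((C₁ i j * 2 * ε i : ℝ≥0) : ℝ≥0∞) := by push_cast; ring
        _ ≤ e := ENNReal.coe_le_coe.2
          ((mul_le_mul' (le_add_self.trans hle) le_rfl).trans (hDε i))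
  refine ⟨iSup_le fun j => iSup₂_le fun x hx => (key j x hx).1,
    iSup_le fun j => iSup₂_le fun x hx => ?_⟩
  change wabs ((1 : ℝ) : WithTop ℝ) * _ ≤ _
  rw [wabs_one, one_mul]
  exact (key j x hx).2

/-- If `X` is a compactly supported vector field near zero and `ψ = exp ∘ X` is a compactly
supported diffeomorphism, then `ψ` and `ψ⁻¹` are small weighted diffeomorphisms. -/
theorem exists_nhds_mem_smallWeightedDiff [FiniteDimensional ℝ E] [T2Space M] (g : RMetric E M)
    {R : ℝ} (hκ : IsLocallyFiniteAtlas κ)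
    (hκr : ∀ p : M, ∃ i, p ∈ (κ i).source ∧ κ i p ∈ Metric.ball (0 : E) (r i)) (hR : 0 < R)
    (hr : ∀ i, Metric.closedBall 0 (r i + R) ⊆ (κ i).target) (hbt : HasBoundedTransitions κ)
    {We : Set (M → WithTop ℝ)}
    (hWe : ∀ f ∈ We, ∀ K, IsCompact K → ∃ C : ℝ≥0, ∀ p ∈ K, wabs (f p) ≤ C)
    (hone : (fun _ => ((1 : ℝ) : WithTop ℝ)) ∈ We) {w : M → ℝ}
    (hw : (fun p => (w p : WithTop ℝ)) ∈ We) {α : ℝ} (hα : 0 < α) :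
    ∃ U ∈ @nhds _ (compactVFTopology E M) 0, ∀ X ∈ U, ∀ ψ : compactDiff E M,
      IsExpComp g X.1 ψ.1.1 →
        ψ.1 ∈ smallWeightedDiff g κ (fun i => Metric.ball 0 (r i + R)) We w α ∧
        ψ.1⁻¹ ∈ smallWeightedDiff g κ (fun i => Metric.ball 0 (r i + R)) We w α := by
  let := compactVFTopology E M
  have hr' : ∀ i, Metric.closedBall 0 (r i) ⊆ (κ i).target := fun i =>
    (Metric.closedBall_subset_closedBall (by linarith)).trans (hr i)
  have hball : ∀ i, Metric.ball 0 (r i + R) ⊆ (κ i).target := fun i =>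
    Metric.ball_subset_closedBall.trans (hr i)
  obtain ⟨hsub, -⟩ := compactVF_subset_weightedVF hκ hκr hr' hbt hWe
  set e : ℝ≥0 := (α / 2).toNNReal with he
  have heα : (e : ℝ≥0∞) < ENNReal.ofReal α :=
    (ENNReal.ofReal_lt_ofReal_iff hα).2 (half_lt_self hα)
  obtain ⟨ε, hε, hεn⟩ := exists_thresholds_vfNorm hκ hr hbt (hWe _ hw)
    (Real.toNNReal_pos.2 (half_pos hα))
  obtain ⟨η, hη, H⟩ := exists_compactVF_reversal g hκ hκr hR hr hε
  set N : VF E M → ℝ≥0∞ := fun X => ⨆ i, ((η i).toNNReal⁻¹ : ℝ≥0) * ballNorm κ r i 1 X with hN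
  have hNl : IsLocalSeminorm κ r N := isLocalSeminorm_iSup_ballNorm hκ hr' _ 1
  have hα' : 0 < ENNReal.ofReal α := ENNReal.ofReal_pos.2 hα
  have hnorm : ∀ f ∈ We, ∀ ℓ : ℕ,
      {X : compactVF E M | vfNorm κ (fun i => (κ i).target) f ℓ X.1 < ENNReal.ofReal α} ∈ 𝓝 0 :=
    fun f hf ℓ => (isLocalSeminorm_vfNorm hκ hκr hbt (hWe f hf) ℓ).mem_nhds_zero
      hκ.mem_maximalAtlas hr' hα'
  -- `N X < 1` says that `X` is below the thresholds `η i`, as needed for `ψ⁻¹`; the bounds for the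
  -- other two norms are those in the definition of the small weighted diffeomorphisms, for `ψ`
  refine ⟨_, inter_mem (hNl.mem_nhds_zero hκ.mem_maximalAtlas hr' one_pos)
    (inter_mem (hnorm _ hw 0) (hnorm _ hone 1)), fun X hX ψ hψ => ⟨⟨X.1, hsub X,
      (vfNorm_mono hball _ _ _).trans_lt hX.2.1, (vfNorm_mono hball _ _ _).trans_lt hX.2.2, hψ⟩,
      ?_⟩⟩
  have hlt : ∀ i, ∀ x ∈ Metric.ball 0 (r i), ∀ l ≤ 1,
      ‖iteratedFDeriv ℝ l (vfLoc X.1 (κ i)) x‖ < η i := by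
    intro i x hx l hl
    have h1 : ‖iteratedFDeriv ℝ l (vfLoc X.1 (κ i)) x‖ₑ ≤ ballNorm κ r i 1 X.1 :=
      (le_wnorm_one l _ (Metric.ball_subset_closedBall hx)).trans
        (Finset.single_le_sum (f := fun l => wnorm (Metric.closedBall 0 (r i)) (fun _ => 1) l
          (vfLoc X.1 (κ i))) (fun _ _ => zero_le) (Finset.mem_range.2 (Nat.lt_succ_of_le hl)))
    have h2 : (((η i).toNNReal⁻¹ : ℝ≥0) : ℝ≥0∞) * ballNorm κ r i 1 X.1 < 1 :=
      (le_iSup (fun i => (((η i).toNNReal⁻¹ : ℝ≥0) : ℝ≥0∞) * ballNorm κ r i 1 X.1) i).trans_lt hX.1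
    have hη0 : (η i).toNNReal ≠ 0 := (Real.toNNReal_pos.2 (hη i)).ne'
    have h3 : ballNorm κ r i 1 X.1 < ENNReal.ofReal (η i) := by
      rw [ENNReal.coe_inv hη0, mul_comm, ← div_eq_mul_inv] at h2
      have := (ENNReal.div_lt_iff (Or.inl (ENNReal.coe_ne_zero.2 hη0))
        (Or.inl ENNReal.coe_ne_top)).1 h2
      rwa [one_mul] at this
    rw [← ENNReal.ofReal_lt_ofReal_iff (hη i), ofReal_norm]
    exact h1.trans_lt h3
  obtain ⟨Y, hY, hYε⟩ := H X ψ hψ fun i x hx => by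
    rw [← norm_iteratedFDeriv_zero (𝕜 := ℝ), ← norm_iteratedFDeriv_one (𝕜 := ℝ)]
    exact ⟨hlt i x hx 0 zero_le_one, hlt i x hx 1 le_rfl⟩
  obtain ⟨h0, h1⟩ := hεn Y.1 hYε
  exact ⟨Y.1, hsub Y, h0.trans_lt heα, h1.trans_lt heα, hY⟩

/-- A subgroup which contains all sufficiently small exponential diffeomorphisms contains the
identity component, being open and closed. -/
theorem compactDiffIdComponent_subset (g : RMetric E M) {H : Subgroup (diffGroup E M)}
    (hH : ∃ U ∈ @nhds _ (compactVFTopology E M) 0, ∀ X ∈ U, ∀ ψ : compactDiff E M,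
      IsExpComp g X.1 ψ.1.1 → ψ.1 ∈ H) {φ : compactDiff E M} (hφ : φ ∈ compactDiffIdComponent g) :
    (φ : diffGroup E M) ∈ H := by
  let := compactDiffTopology g
  obtain ⟨U, hU, hUH⟩ := hH
  have h1 : IsOpen {φ : compactDiff E M | φ.1 ∈ H} := by
    refine fun φ hφ => ⟨U, hU, fun X hX ψ hψ => ?_⟩
    have := H.mul_mem (hUH X hX _ hψ) hφ
    simpa using this
  have h2 : IsOpen {φ : compactDiff E M | φ.1 ∈ H}ᶜ := by
    refine fun φ hφ => ⟨U, hU, fun X hX ψ hψ hψH => hφ ?_⟩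
    have := H.mul_mem (H.inv_mem (hUH X hX _ hψ)) hψH
    simpa using this
  exact IsClopen.connectedComponent_subset ⟨⟨h2⟩, h1⟩ (mem_ofPred_eq ▸ H.one_mem) hφ

end SmallWeightedDiff

end WeightedDiffeo

end

theorem mainTheorem2
    {E : Type*} [NormedAddCommGroup E] [NormedSpace ℝ E] [FiniteDimensional ℝ E] [Nontrivial E]
    {M : Type*} [TopologicalSpace M] [T2Space M] [ChartedSpace E M] [IsManifold 𝓘(ℝ, E) ∞ M]
    (g : WeightedDiffeo.RMetric E M)
    {ι : Type*} (κ : ι → OpenPartialHomeomorph M E)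
    (hκ : WeightedDiffeo.IsLocallyFiniteAtlas κ)
    (hpt : ∃ p : M, ∃! i, p ∈ (κ i).source)
    (r ε : ι → ℝ) (R : ℝ) (hadapted : WeightedDiffeo.IsAdapted κ r ε R)
    (hε : 0 < ⨅ i, ε i) (hr : 0 < ⨅ i, r i)
    (W : Set (M → ℝ)) (hone : (fun _ => 1) ∈ W)
    (hbdd : ∀ f ∈ W, ∀ K : Set M, IsCompact K → ∃ C : ℝ, ∀ p ∈ K, |f p| ≤ C)
    (V : ι → Set E) (hV : ∀ i, V i = Metric.ball 0 (r i + R))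
    (σ : ℝ) (hσ : 0 < σ ∧ σ < 1)
    (δ : ι → ℝ)
    (hδ : ∀ i, 0 < δ i ∧ ENNReal.ofReal (δ i) <
      WeightedDiffeo.radExpFibInv (WeightedDiffeo.localMetric g (κ i)) (κ i).target (V i) σ *
        WeightedDiffeo.quotNorm (WeightedDiffeo.localMetric g (κ i)) (V i))
    (w : M → ℝ)
    (hw : ∃ K : ℝ, 0 < K ∧
      WeightedDiffeo.IsAdjustingWeight V (WeightedDiffeo.weightLoc κ (fun p => K * w p))
        (WeightedDiffeo.adjustRadii g κ V ε δ σ))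
    (δE δL : ι → ℝ)
    (hδE : ∀ i, 0 < δE i ∧ ENNReal.ofReal (δE i) <
      WeightedDiffeo.expBound (WeightedDiffeo.localMetric g (κ i)) (κ i).target (V i))
    (hδL : ∀ i, 0 < δL i ∧ ENNReal.ofReal (δL i) <
      WeightedDiffeo.logBound (WeightedDiffeo.localMetric g (κ i)) (κ i).target (V i))
    (We : Set (M → WithTop ℝ))
    (hWe : ∀ f ∈ W, (fun p => (f p : WithTop ℝ)) ∈ We)
    (hwWe : (fun p => (w p : WithTop ℝ)) ∈ We)
    (hloc : WeightedDiffeo.LocallyBoundedBy ((fun f p => ((f p : ℝ) : WithTop ℝ)) '' W) We)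
    (hsat₁ : WeightedDiffeo.IsSaturatedExpLog g κ V δE δL We)
    (hsat₂ : WeightedDiffeo.IsSaturatedTransition κ We) :
    (∃ hsub : ∀ X : WeightedDiffeo.compactVF E M, X.1 ∈ WeightedDiffeo.weightedVF κ We,
      Continuous[WeightedDiffeo.compactVFTopology E M, WeightedDiffeo.weightedVFTopology κ We]
        (fun X => ⟨X.1, hsub X⟩)) ∧
    ∀ α : ℝ, 0 < α → ∀ φ ∈ WeightedDiffeo.compactDiffIdComponent g,
      (φ : WeightedDiffeo.diffGroup E M) ∈ WeightedDiffeo.weightedDiff g κ V We w α := by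
  have hr' : ∀ i, Metric.closedBall 0 (r i) ⊆ (κ i).target := fun i =>
    (Metric.closedBall_subset_closedBall (by linarith [hadapted.R_pos])).trans
      (hadapted.closedBall_subset i)
  have hbd : ∀ f ∈ We, ∀ K, IsCompact K → ∃ C : ℝ≥0, ∀ p ∈ K, WeightedDiffeo.wabs (f p) ≤ C :=
    fun f hf K hK => WeightedDiffeo.exists_wabs_le_of_isCompact hbdd hloc hf hK
  have hone' : (fun _ => ((1 : ℝ) : WithTop ℝ)) ∈ We := hWe _ hone
  have hbt := WeightedDiffeo.hasBoundedTransitions hone' hbd hsat₂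
  refine ⟨WeightedDiffeo.compactVF_subset_weightedVF hκ hadapted.cover hr' hbt hbd,
    fun α hα φ hφ => WeightedDiffeo.compactDiffIdComponent_subset g ?_ hφ⟩
  obtain rfl : V = fun i => Metric.ball 0 (r i + R) := funext hV
  obtain ⟨U, hU, H⟩ := WeightedDiffeo.exists_nhds_mem_smallWeightedDiff g hκ hadapted.cover
    hadapted.R_pos hadapted.closedBall_subset hbt hbd hone' hwWe hα
  exact ⟨U, hU, fun X hX ψ hψ => Subgroup.subset_closure (H X hX ψ hψ)⟩
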